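/- Let $d\ge 3$. For $x\in\mathbb Z^d$ and $r\ge 0$ let $B(x,r)=\{y\in\mathbb Z^d:\ |y-x|_\infty\le r\}$, write $|\cdot|$ for cardinality, $\mathbb N=\{0,1,2,\dots\}$ and $\mathbb N_*=\{1,2,\dots\}$. Let $P_0$ be the law of the continuous-time simple random walk $(X_t)_{t\ge0}$ on $\mathbb Z^d$ with unit jump rate started at $0$, and for $U\subseteq\mathbb Z^d$ let $H_U=\inf\{t\ge 0:\ X_t\in U\}$ (with $\inf\emptyset=\infty$). For an integer $J\ge1$ set $$L(J)=\min\{L\ge5 \text{ integer}:\ d\,2^{d-1}2^{-L}\le(200J)^{-1}\},\qquad \widetilde\alpha=\tfrac13 4^{-d}.$$ Proposition 3.1. There exist a non-negative doubly indexed sequence $\gamma_{I,J}$, $I,J\ge1$, with $\lim_{I\to\infty}\gamma_{I,J}=0$ for each $J\ge1$, and a sequence of integers $r_{\min}(J)\ge6$, $J\ge1$ (both depending only on $d$ besides their indices), with the following property. Let $I,J\ge1$ and let $L_1$ be an integer with $L_1\ge r_{\min}(J)$. Let $U_0$ be a finite non-empty subset of $\mathbb Z^d$ and $U_1=\mathbb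 Z^d\setminus U_0$, let $L\ge L(J)$ be an integer, let $h\in\mathbb N$, and let $\mathcal A\subseteq (J+1)L\,\mathbb N_*+h$ be a finite set with $|\mathcal A|=I$ such that $$|B(0,2^mL_1)\cap U_1|\le\tfrac12\,|B(0,2^mL_1)|\quad\text{for all } m\in\mathcal A.$$ Set $\mathcal A_*=\{m\in\mathbb N:\ m+jL\in\mathcal A\text{ for some integer } 0\le j\le J\}$ and define the $(\mathcal A_*,J)$-resonance set $$Res_{\mathcal A_*,J}=\Big\{x\in\mathbb Z^d:\ \sum_{m\in\mathcal A_*}1\Big\{\frac{|B(x,2^{m+2}L_1)\cap U_1|}{|B(x,2^{m+2}L_1)|}\in[\widetilde\alpha,1-\widetilde\alpha]\Big\}\ge J\Big\}.$$ Then $$P_0\big[H_{Res_{\mathcal A_*,J}}=\infty\big]\le\gamma_{I,J}.$$ -/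

import Mathlib

open MeasureTheory ProbabilityTheory Filter Topology
open scoped NNReal ENNReal

noncomputable section

namespace ResonanceSets

/-! ### Continuous-time simple random walk on `ℤ^d` with unit jump rate -/

/-- The law of one step of simple random walk on `ℤ^d`: the uniform distribution on the `2d`
neighbours `± e_i` of the origin. -/
def stepLaw (d : ℕ) : Measure (Fin d → ℤ) :=
  (2 * d : ℝ≥0∞)⁻¹ •
    ∑ i : Fin d, (Measure.dirac (Pi.single i (1 : ℤ)) + Measure.dirac (Pi.single i (-1 : ℤ)))

/-- The sample space: a sequence of steps in `ℤ^d` and a sequence of holding times. -/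
abbrev Sample (d : ℕ) : Type := (ℕ → Fin d → ℤ) × (ℕ → ℝ)

/-- The underlying probability: the steps are i.i.d. uniform on the neighbours of the origin, the
holding times are i.i.d. exponential with parameter `1`, and the two sequences are independent. -/
def walkMeasure (d : ℕ) : Measure (Sample d) :=
  (Measure.infinitePi fun _ : ℕ => stepLaw d).prod (Measure.infinitePi fun _ : ℕ => expMeasure 1)

/-- The time of the `n`-th jump (with the convention that the `0`-th one is at time `0`). -/
def jumpTime {d : ℕ} (n : ℕ) (ω : Sample d) : ℝ := ∑ k ∈ Finset.range n, ω.2 k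

/-- The number of jumps performed up to time `t`. -/
def jumpCount {d : ℕ} (t : ℝ≥0) (ω : Sample d) : ℕ := {n : ℕ | jumpTime (n + 1) ω ≤ t}.ncard

/-- The position at time `t` of the walk that starts at `x`. Under `walkMeasure d`, the process
`walk x` is the continuous-time simple random walk on `ℤ^d` with unit jump rate started at `x`. -/
def walk {d : ℕ} (x : Fin d → ℤ) (t : ℝ≥0) (ω : Sample d) : Fin d → ℤ :=
  x + ∑ k ∈ Finset.range (jumpCount t ω), ω.1 k

/-- The entrance time `H_U = inf {t ≥ 0; X_t ∈ U}` of the walk started at `x`, equal to `⊤` if the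
walk never visits `U`. -/
def entranceTime {d : ℕ} (x : Fin d → ℤ) (U : Set (Fin d → ℤ)) (ω : Sample d) : WithTop ℝ≥0 :=
  hittingAfter (walk x) U 0 ω

/-! ### Balls, densities and resonance sets -/

/-- `B(x,r)`: the closed ball in `ℤ^d` with centre `x` and radius `r` for the supremum distance. -/
abbrev ball {d : ℕ} (x : Fin d → ℤ) (r : ℝ) : Set (Fin d → ℤ) := Metric.closedBall x r

/-- The relative volume `|B(x,r) ∩ U| / |B(x,r)|`. -/
def density {d : ℕ} (U : Set (Fin d → ℤ)) (x : Fin d → ℤ) (r : ℝ) : ℝ :=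
  ((ball x r ∩ U).ncard : ℝ) / ((ball x r).ncard : ℝ)

/-- The minimal separation of dyadic scales,
`L(J) = min {L ≥ 5; d 2^(d-1) 2^(-L) ≤ (200 J)⁻¹}`. -/
def minSeparation (d J : ℕ) : ℕ :=
  sInf {L : ℕ | 5 ≤ L ∧ (d : ℝ) * 2 ^ (d - 1) * ((2 : ℝ) ^ L)⁻¹ ≤ (200 * (J : ℝ))⁻¹}

/-- The enlarged set of scales `A_* = {m ∈ ℕ; m + j L ∈ A for some 0 ≤ j ≤ J}`. -/
def enlargedScales (J L : ℕ) (A : Finset ℕ) : Set ℕ :=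
  {m : ℕ | ∃ j : ℕ, j ≤ J ∧ m + j * L ∈ A}

/-- `α̃ = 4^(-d) / 3`. -/
def alphaTilde (d : ℕ) : ℝ := 1 / 3 * ((4 : ℝ) ^ d)⁻¹

/-- The `(S,J)`-resonance set of `U₁` at base scale `L₁`: the points `x` for which there are at
least `J` scales `m ∈ S` such that the relative volume of `U₁` in `B(x, 2^(m+2) L₁)` lies in
`[α̃, 1 - α̃]`. (The set `S` is finite in all uses.) -/
def resonanceSet {d : ℕ} (U₁ : Set (Fin d → ℤ)) (L₁ : ℕ) (S : Set ℕ) (J : ℕ) :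
    Set (Fin d → ℤ) :=
  {x | J ≤ {m ∈ S | density U₁ x (2 ^ (m + 2) * L₁)
    ∈ Set.Icc (alphaTilde d) (1 - alphaTilde d)}.ncard}

/-! ### The walk is governed by a genuine probability measure -/

theorem isProbabilityMeasure_stepLaw {d : ℕ} (hd : 1 ≤ d) : IsProbabilityMeasure (stepLaw d) := by
  constructor
  have h0 : (2 * d : ℝ≥0∞) ≠ 0 := by
    simp only [ne_eq, mul_eq_zero, Nat.cast_eq_zero]; norm_num; omega
  have h1 : (2 * d : ℝ≥0∞) ≠ ⊤ := ENNReal.mul_ne_top (by simp) (by simp)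
  simp only [stepLaw, Measure.smul_apply, Measure.coe_finsetSum, Finset.sum_apply,
    Measure.coe_add, Pi.add_apply, measure_univ, Finset.sum_const, Finset.card_univ,
    Fintype.card_fin, smul_eq_mul, nsmul_eq_mul, one_add_one_eq_two]
  rw [mul_comm (d : ℝ≥0∞) 2]
  exact ENNReal.inv_mul_cancel h0 h1

theorem isProbabilityMeasure_walkMeasure {d : ℕ} (hd : 1 ≤ d) :
    IsProbabilityMeasure (walkMeasure d) := by
  have := isProbabilityMeasure_stepLaw hd
  have := isProbabilityMeasure_expMeasure (r := 1) one_pos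
  unfold walkMeasure
  infer_instance

end ResonanceSets

end

/-!
The holding times are positive, so the walk visits exactly the points of its jump chain, and the
quantity to be bounded is `u 0`, where `u x` is the probability that the jump chain started at `x`
avoids the resonance set. The function `u` takes values in `[0, 1]`, vanishes on the resonance set
and is harmonic elsewhere; from here on the argument is analytic, with the maximum principle on
finite sets (`nonpos_of_le_nbrAvg`) in place of stopping times. The bound obtained is
`γ I J = (1 - η ^ J) ^ I`, with `η` depending on `d` and `J` only.

*One scale.* Write `s m x` for the relative volume of `U₁` in the ball of radius `2 ^ m * L₁` around
`x`. If `s m x` is close to `1 / 2`, then the average of `s (m - L)` over the ball is close to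
`1 / 2` as well, so that neither low nor high values of `s (m - L)` can prevail in it
(`le_card_density_ge`). A walk hits any set of positive relative volume in a ball, before leaving
the ball of twice the radius, with a probability bounded below (`mul_hitConst_le`; the lower bound
on the heat kernel comes from the discrete sine basis). As relative volumes change little in one
step, the walk has to meet intermediate values of `s (m - L)` on its way from low to high ones
(`mul_hitConst_le_of_density_mem`). Iterating `J` times, from each point where `s m` has just
exceeded `1 / 2` the walk reaches, with probability at least `η ^ J` and within distance
`3 * 2 ^ m * L₁`, a point that lies close to balanced points of each of the scales
`m, m - L, …, m - J L` (`exists_isBarrier_balancedCore`). The balls of four times the radii around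
such a point are still balanced up to a factor `4 ^ (-d)`, which is what resonance requires, and
this is insensitive to perturbations by a fraction of `2 ^ (m - J L) * L₁`.

*All scales.* At `0` all `s m`, `m ∈ A`, are at most `1 / 2`, whereas `s m = 1` far away, as `U₀` is
finite. Thus one attempt as above is launched for each `m ∈ A`, at the time when `s m` exceeds
`1 / 2`. These times come in no particular order and the attempts overlap. This is dealt with by
attributing each step of the walk to the smallest scale with an ongoing attempt, and by letting each
attempt follow a virtual position which is moved by its own steps only. The failure probabilities,
at most `1 - η ^ J` each, then multiply. The virtual position differs from the true one by at most
twice the total range of the attempts at smaller scales, and the sparsity of `A` makes this smaller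
than the permitted perturbation (`sum_range_le`). In analytic terms, a product over the
scales is a supersolution that dominates `u` (`le_pow_card_of_attempts`).
-/

namespace ResonanceSets

variable {d : ℕ}

/-! ### Nearest-neighbour averages and the maximum principle -/

/-- The average of `f` over the `2d` nearest neighbours of `x`, that is, the expectation of `f`
after one step of the walk started at `x`. -/
noncomputable def nbrAvg (f : (Fin d → ℤ) → ℝ) (x : Fin d → ℤ) : ℝ :=
  (2 * d : ℝ)⁻¹ * ∑ i : Fin d, (f (x + Pi.single i 1) + f (x + Pi.single i (-1)))

/-- `e` is one of the `2d` steps `± e_i` of the walk. -/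
def IsStep (e : Fin d → ℤ) : Prop := ∃ i, e = Pi.single i 1 ∨ e = Pi.single i (-1)

theorem isStep_single_one (i : Fin d) : IsStep (Pi.single i (1 : ℤ)) := ⟨i, Or.inl rfl⟩

theorem isStep_single_neg_one (i : Fin d) : IsStep (Pi.single i (-1 : ℤ)) := ⟨i, Or.inr rfl⟩

theorem IsStep.abs_le {e : Fin d → ℤ} (he : IsStep e) (j : Fin d) : |e j| ≤ 1 := by
  obtain ⟨i, rfl | rfl⟩ := he <;> by_cases h : j = i
  · subst h; simp
  · simp [Pi.single_eq_of_ne h]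
  · subst h; simp
  · simp [Pi.single_eq_of_ne h]

theorem IsStep.norm_le {e : Fin d → ℤ} (he : IsStep e) : ‖e‖ ≤ 1 := by
  refine (pi_norm_le_iff_of_nonneg zero_le_one).2 fun j => ?_
  rw [Int.norm_eq_abs]
  exact_mod_cast he.abs_le j

theorem nbrAvg_le_nbrAvg {f g : (Fin d → ℤ) → ℝ} {x : Fin d → ℤ}
    (h : ∀ e, IsStep e → f (x + e) ≤ g (x + e)) : nbrAvg f x ≤ nbrAvg g x := by
  unfold nbrAvg
  gcongr with i
  · exact h _ (isStep_single_one i)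
  · exact h _ (isStep_single_neg_one i)

theorem nbrAvg_const (hd : 0 < d) (c : ℝ) (x : Fin d → ℤ) : nbrAvg (fun _ => c) x = c := by
  have : (d : ℝ) ≠ 0 := by positivity
  simp only [nbrAvg, Finset.sum_const, Finset.card_univ, Fintype.card_fin, nsmul_eq_mul]
  field_simp
  ring

theorem nbrAvg_sub (f g : (Fin d → ℤ) → ℝ) (x : Fin d → ℤ) :
    nbrAvg (fun y => f y - g y) x = nbrAvg f x - nbrAvg g x := by
  simp only [nbrAvg, ← mul_sub, ← Finset.sum_sub_distrib]
  congr 1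
  exact Finset.sum_congr rfl fun i _ => by ring

theorem nbrAvg_const_mul (c : ℝ) (f : (Fin d → ℤ) → ℝ) (x : Fin d → ℤ) :
    nbrAvg (fun y => c * f y) x = c * nbrAvg f x := by
  simp only [nbrAvg, ← mul_add, ← Finset.mul_sum]
  ring

theorem nbrAvg_sum {ι : Type*} (s : Finset ι) (f : ι → (Fin d → ℤ) → ℝ) (x : Fin d → ℤ) :
    nbrAvg (fun y => ∑ j ∈ s, f j y) x = ∑ j ∈ s, nbrAvg (f j) x := by
  simp only [nbrAvg, ← Finset.mul_sum]
  rw [Finset.sum_comm]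
  simp only [← Finset.sum_add_distrib]

theorem nbrAvg_comp_add (f : (Fin d → ℤ) → ℝ) (a x : Fin d → ℤ) :
    nbrAvg (fun y => f (a + y)) x = nbrAvg f (a + x) := by
  simp only [nbrAvg, add_assoc]

theorem nbrAvg_nonneg {f : (Fin d → ℤ) → ℝ} (h : ∀ x, 0 ≤ f x) (x : Fin d → ℤ) :
    0 ≤ nbrAvg f x := by
  unfold nbrAvg
  exact mul_nonneg (by positivity) (Finset.sum_nonneg fun i _ => add_nonneg (h _) (h _))

/-- Maximum principle on a finite set: a function which is subharmonic where it is positive, and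
non-positive on the outer boundary, is non-positive. -/
theorem nonpos_of_le_nbrAvg (hd : 0 < d) {S : Set (Fin d → ℤ)} (hS : S.Finite)
    {F : (Fin d → ℤ) → ℝ} (hin : ∀ x ∈ S, F x ≤ 0 ∨ F x ≤ nbrAvg F x)
    (hout : ∀ x ∈ S, ∀ e, IsStep e → x + e ∉ S → F (x + e) ≤ 0) : ∀ x ∈ S, F x ≤ 0 := by
  by_contra! hcon
  obtain ⟨x₀, hx₀, hpos⟩ := hcon
  obtain ⟨x₁, hx₁, hmax⟩ := Set.exists_max_image S F hS ⟨x₀, hx₀⟩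
  let i₀ : Fin d := ⟨0, hd⟩
  -- among the maximizers, one that lies furthest in the first coordinate direction
  obtain ⟨x, ⟨hxS, hxM⟩, hx⟩ := Set.exists_max_image {x ∈ S | F x = F x₁} (fun x => x i₀)
    (hS.subset (Set.sep_subset _ _)) ⟨x₁, hx₁, rfl⟩
  have hM : 0 < F x := by rw [hxM]; exact hpos.trans_le (hmax x₀ hx₀)
  have hle : ∀ e, IsStep e → F (x + e) ≤ F x := fun e he => by
    by_cases h : x + e ∈ S
    · rw [hxM]; exact hmax _ h
    · exact (hout x hxS e he h).trans hM.le
  have hlt : F (x + Pi.single i₀ 1) < F x := by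
    by_cases h : x + Pi.single i₀ 1 ∈ S
    · refine lt_of_le_of_ne (hle _ (isStep_single_one _)) fun heq => ?_
      have := hx _ ⟨h, heq.trans hxM⟩
      simp at this
    · exact (hout x hxS _ (isStep_single_one _) h).trans_lt hM
  have h2 : F x ≤ nbrAvg F x := (hin x hxS).resolve_left (not_le.2 hM)
  have h3 : nbrAvg F x < nbrAvg (fun _ => F x) x := by
    unfold nbrAvg
    refine mul_lt_mul_of_pos_left ?_ (by positivity)
    refine Finset.sum_lt_sum (fun i _ => add_le_add (hle _ (isStep_single_one i))
      (hle _ (isStep_single_neg_one i))) ⟨i₀, Finset.mem_univ _, ?_⟩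
    exact add_lt_add_of_lt_of_le hlt (hle _ (isStep_single_neg_one i₀))
  rw [nbrAvg_const hd] at h3
  exact absurd h2 (not_le.2 h3)

theorem tendsto_nbrAvg {f : ℕ → (Fin d → ℤ) → ℝ} {v : (Fin d → ℤ) → ℝ}
    (h : ∀ x, Tendsto (fun n => f n x) atTop (𝓝 (v x))) (x : Fin d → ℤ) :
    Tendsto (fun n => nbrAvg (f n) x) atTop (𝓝 (nbrAvg v x)) :=
  (tendsto_finsetSum _ fun _ _ => (h _).add (h _)).const_mul _

/-- The probability of hitting `C` before leaving `D`, as a function of the starting point: the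
limit of the probabilities of doing so within `n` steps. -/
theorem exists_hitting_function (hd : 0 < d) (C D : Set (Fin d → ℤ)) :
    ∃ v : (Fin d → ℤ) → ℝ, (∀ x, 0 ≤ v x) ∧ (∀ x, v x ≤ 1) ∧ (∀ x ∈ C, v x = 1) ∧
      (∀ x ∈ D \ C, v x = nbrAvg v x) ∧ ∀ x, x ∉ C → x ∉ D → v x = 0 := by
  classical
  let T : ((Fin d → ℤ) → ℝ) → (Fin d → ℤ) → ℝ := fun f x =>
    if x ∈ C then 1 else if x ∈ D then nbrAvg f x else 0
  let f : ℕ → (Fin d → ℤ) → ℝ := fun n => T^[n] 0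
  have hsucc : ∀ n, f (n + 1) = T (f n) := fun n => Function.iterate_succ_apply' T n 0
  have h0 : ∀ n x, 0 ≤ f n x := by
    intro n
    induction n with
    | zero => intro x; exact le_rfl
    | succ n ih =>
      intro x
      rw [hsucc]
      simp only [T]
      split_ifs
      exacts [zero_le_one, nbrAvg_nonneg ih x, le_rfl]
  have h1 : ∀ n x, f n x ≤ 1 := by
    intro n
    induction n with
    | zero => intro x; exact zero_le_one
    | succ n ih =>
      intro x
      rw [hsucc]
      simp only [T]
      split_ifs
      · exact le_rfl
      · exact (nbrAvg_le_nbrAvg fun e _ => ih (x + e)).trans (nbrAvg_const hd 1 x).le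
      · exact zero_le_one
  have hmono : ∀ n x, f n x ≤ f (n + 1) x := by
    intro n
    induction n with
    | zero => intro x; exact h0 1 x
    | succ n ih =>
      intro x
      rw [hsucc, hsucc (n + 1)]
      simp only [T]
      split_ifs
      exacts [le_rfl, nbrAvg_le_nbrAvg fun e _ => ih _, le_rfl]
  have hlim : ∀ x, Tendsto (fun n => f n x) atTop (𝓝 (⨆ n, f n x)) := fun x =>
    tendsto_atTop_ciSup (monotone_nat_of_le_succ fun n => hmono n x)
      ⟨1, by rintro _ ⟨n, rfl⟩; exact h1 n x⟩
  have hlim' : ∀ x, Tendsto (fun n => T (f n) x) atTop (𝓝 (⨆ n, f n x)) := fun x => by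
    simpa only [hsucc] using (tendsto_add_atTop_iff_nat 1).2 (hlim x)
  refine ⟨fun x => ⨆ n, f n x, fun x => ge_of_tendsto' (hlim x) fun n => h0 n x,
    fun x => le_of_tendsto' (hlim x) fun n => h1 n x, fun x hx => ?_, fun x hx => ?_,
    fun x hC hD => ?_⟩
  · refine tendsto_nhds_unique (hlim' x) ?_
    simp only [T, if_pos hx]
    exact tendsto_const_nhds
  · refine tendsto_nhds_unique (hlim' x) ?_
    simp only [T, if_neg hx.2, if_pos hx.1]
    exact tendsto_nbrAvg hlim x
  · refine tendsto_nhds_unique (hlim' x) ?_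
    simp only [T, if_neg hC, if_neg hD]
    exact tendsto_const_nhds

/-! ### Hitting sets of positive density in a box -/

theorem two_mul_sin_mul_sum_cos (θ : ℝ) (N : ℕ) :
    2 * Real.sin (θ / 2) * ∑ k ∈ Finset.range N, Real.cos (k * θ)
      = Real.sin (N * θ - θ / 2) + Real.sin (θ / 2) := by
  induction N with
  | zero => simp [Real.sin_neg]
  | succ n ih =>
    rw [Finset.sum_range_succ, mul_add, ih]
    have h1 : ((n + 1 : ℕ) : ℝ) * θ - θ / 2 = n * θ + θ / 2 := by push_cast; ring
    rw [h1, Real.sin_add, Real.sin_sub]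
    ring

theorem sum_cos_eq {N : ℕ} (hN : 0 < N) {m : ℤ} (hm : ¬ (2 * (N : ℤ)) ∣ m) :
    ∑ k ∈ Finset.range N, Real.cos (k * (Real.pi * m / N))
      = (1 - Real.cos (Real.pi * m)) / 2 := by
  have hN' : (N : ℝ) ≠ 0 := by positivity
  have hs : Real.sin (Real.pi * m / N / 2) ≠ 0 := by
    rw [Ne, Real.sin_eq_zero_iff]
    rintro ⟨n, hn⟩
    apply hm
    refine ⟨n, ?_⟩
    have h2 : (m : ℝ) = 2 * N * n := by
      have := Real.pi_ne_zero
      field_simp at hn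
      linarith
    exact_mod_cast h2
  have h := two_mul_sin_mul_sum_cos (Real.pi * m / N) N
  have h1 : (N : ℝ) * (Real.pi * m / N) = m * Real.pi := by field_simp
  rw [h1, Real.sin_sub, Real.sin_int_mul_pi] at h
  rw [mul_comm Real.pi (m : ℝ)] at h hs ⊢
  apply mul_left_cancel₀ hs
  linarith

/-- Orthogonality of the discrete sine basis. -/
theorem sum_sin_mul_sin {N : ℕ} {a b : ℤ} (ha : 0 < a) (haN : a < N) (hb : 0 < b) (hbN : b < N) :
    ∑ k ∈ Finset.range N, Real.sin (k * (Real.pi * a / N)) * Real.sin (k * (Real.pi * b / N))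
      = if a = b then (N : ℝ) / 2 else 0 := by
  have hN : 0 < N := by omega
  have h1 : ∀ k : ℕ, Real.sin (k * (Real.pi * a / N)) * Real.sin (k * (Real.pi * b / N))
      = (Real.cos (k * (Real.pi * (a - b : ℤ) / N))
        - Real.cos (k * (Real.pi * (a + b : ℤ) / N))) / 2 := fun k => by
    have e1 : (k : ℝ) * (Real.pi * (a - b : ℤ) / N)
        = k * (Real.pi * a / N) - k * (Real.pi * b / N) := by push_cast; ring
    have e2 : (k : ℝ) * (Real.pi * (a + b : ℤ) / N)
        = k * (Real.pi * a / N) + k * (Real.pi * b / N) := by push_cast; ring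
    rw [e1, e2, Real.cos_sub, Real.cos_add]
    ring
  have hplus : ¬ (2 * (N : ℤ)) ∣ (a + b) := fun h => by
    have := Int.le_of_dvd (by omega) h
    omega
  simp only [h1, ← Finset.sum_div, Finset.sum_sub_distrib]
  rw [sum_cos_eq hN hplus]
  have hper : Real.cos (Real.pi * (a + b : ℤ)) = Real.cos (Real.pi * (a - b : ℤ)) := by
    rw [← Real.cos_add_int_mul_two_pi (Real.pi * (a - b : ℤ)) b]
    congr 1
    push_cast
    ring
  split_ifs with h
  · subst h
    rw [hper]
    simp
  · have hminus : ¬ (2 * (N : ℤ)) ∣ (a - b) := fun h' => by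
      have := Int.le_of_dvd (b := |a - b|) (abs_pos.2 (sub_ne_zero.2 h)) ((dvd_abs _ _).2 h')
      have h3 : |a - b| < N := abs_lt.2 ⟨by omega, by omega⟩
      omega
    rw [sum_cos_eq hN hminus, hper]
    ring

/-- The eigenfunction of the walk killed outside of `{1, …, N - 1}^d` with frequencies `κ`. -/
noncomputable def sineProd (N : ℕ) (κ : Fin d → ℕ) (x : Fin d → ℤ) : ℝ :=
  ∏ i, Real.sin (κ i * (Real.pi * x i / N))

theorem nbrAvg_sineProd (N : ℕ) (κ : Fin d → ℕ) (x : Fin d → ℤ) :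
    nbrAvg (sineProd N κ) x
      = ((d : ℝ)⁻¹ * ∑ i, Real.cos (κ i * (Real.pi / N))) * sineProd N κ x := by
  have key : ∀ i : Fin d, sineProd N κ (x + Pi.single i 1) + sineProd N κ (x + Pi.single i (-1))
      = 2 * Real.cos (κ i * (Real.pi / N)) * sineProd N κ x := fun i => by
    have hsplit : ∀ c : ℤ, sineProd N κ (x + Pi.single i c)
        = Real.sin (κ i * (Real.pi * (x i + c : ℤ) / N))
          * ∏ j ∈ Finset.univ.erase i, Real.sin (κ j * (Real.pi * x j / N)) := fun c => by
      unfold sineProd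
      rw [← Finset.mul_prod_erase _ _ (Finset.mem_univ i)]
      congr 1
      · simp
      · refine Finset.prod_congr rfl fun j hj => ?_
        rw [Pi.add_apply, Pi.single_eq_of_ne (Finset.ne_of_mem_erase hj), add_zero]
    have h0 := hsplit 0
    rw [Pi.single_zero, add_zero, add_zero] at h0
    rw [hsplit, hsplit, h0, ← add_mul, ← mul_assoc]
    congr 1
    have e1 : (κ i : ℝ) * (Real.pi * (x i + 1 : ℤ) / N)
        = κ i * (Real.pi * x i / N) + κ i * (Real.pi / N) := by push_cast; ring
    have e2 : (κ i : ℝ) * (Real.pi * (x i + -1 : ℤ) / N)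
        = κ i * (Real.pi * x i / N) - κ i * (Real.pi / N) := by push_cast; ring
    rw [e1, e2, Real.sin_add, Real.sin_sub]
    ring
  unfold nbrAvg
  simp only [key, ← Finset.sum_mul, ← Finset.mul_sum, mul_inv]
  ring

/-- The spectral gap `1 - μ_κ` of the eigenfunction `sineProd N κ`. -/
noncomputable def sineGap (d N : ℕ) (κ : Fin d → ℕ) : ℝ :=
  1 - (d : ℝ)⁻¹ * ∑ i, Real.cos (κ i * (Real.pi / N))

/-- The transition kernel after `n` steps of the lazy walk which moves with probability `ε` and is
killed outside of `{1, …, N - 1}^d`, in its spectral representation. -/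
noncomputable def lazyKernel (N : ℕ) (ε : ℝ) (n : ℕ) (x y : Fin d → ℤ) : ℝ :=
  ∑ κ ∈ Fintype.piFinset fun _ : Fin d => Finset.range N,
    (1 - ε * sineGap d N κ) ^ n * ((2 / N) ^ d * sineProd N κ y) * sineProd N κ x

theorem lazyKernel_zero {N : ℕ} {ε : ℝ} {x y : Fin d → ℤ} (hx : ∀ i, 0 < x i ∧ x i < N)
    (hy : ∀ i, 0 < y i ∧ y i < N) :
    lazyKernel N ε 0 x y = if x = y then 1 else 0 := by
  have h1 : lazyKernel N ε 0 x y = ∏ i, ∑ k ∈ Finset.range N, 2 / (N : ℝ) *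
      (Real.sin (k * (Real.pi * x i / N)) * Real.sin (k * (Real.pi * y i / N))) := by
    rw [Finset.prod_univ_sum]
    refine Finset.sum_congr rfl fun κ _ => ?_
    simp only [sineProd, pow_zero, one_mul, Finset.prod_mul_distrib, Finset.prod_const,
      Finset.card_univ, Fintype.card_fin]
    ring
  rw [h1]
  simp only [← Finset.mul_sum]
  split_ifs with h
  · subst h
    refine Finset.prod_eq_one fun i _ => ?_
    rw [sum_sin_mul_sin (hx i).1 (hx i).2 (hx i).1 (hx i).2, if_pos rfl]
    have : (N : ℝ) ≠ 0 := by
      have := hx i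
      have : 0 < N := by omega
      positivity
    field_simp
  · obtain ⟨i, hi⟩ := Function.ne_iff.1 h
    refine Finset.prod_eq_zero (Finset.mem_univ i) ?_
    rw [sum_sin_mul_sin (hx i).1 (hx i).2 (hy i).1 (hy i).2, if_neg hi, mul_zero]

theorem lazyKernel_succ (N : ℕ) (ε : ℝ) (n : ℕ) (x y : Fin d → ℤ) :
    lazyKernel N ε (n + 1) x y
      = (1 - ε) * lazyKernel N ε n x y + ε * nbrAvg (fun x => lazyKernel N ε n x y) x := by
  unfold lazyKernel
  rw [nbrAvg_sum, Finset.mul_sum, Finset.mul_sum, ← Finset.sum_add_distrib]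
  refine Finset.sum_congr rfl fun κ _ => ?_
  rw [nbrAvg_const_mul, nbrAvg_sineProd, sineGap]
  ring

theorem lazyKernel_boundary {N : ℕ} (hN : 0 < N) (ε : ℝ) (n : ℕ) {x : Fin d → ℤ}
    (y : Fin d → ℤ) {i : Fin d} (hx : x i = 0 ∨ x i = N) : lazyKernel N ε n x y = 0 := by
  have hN' : (N : ℝ) ≠ 0 := by positivity
  refine Finset.sum_eq_zero fun κ _ => ?_
  have : sineProd N κ x = 0 := by
    refine Finset.prod_eq_zero (Finset.mem_univ i) ?_
    rcases hx with h | h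
    · simp [h]
    · rw [h]
      have : (κ i : ℝ) * (Real.pi * ((N : ℤ) : ℝ) / N) = κ i * Real.pi := by
        push_cast; field_simp
      rw [this, Real.sin_nat_mul_pi]
  rw [this, mul_zero]

/-- A supersolution that is at least `1` on `F` dominates the probability that the lazy killed walk
sits in `F` at time `n`. -/
theorem sum_lazyKernel_le {N : ℕ} (hN : 0 < N) {ε : ℝ} (h0 : 0 ≤ ε) (h1 : ε ≤ 1)
    {v : (Fin d → ℤ) → ℝ} (hv0 : ∀ x, 0 ≤ v x)
    (hv : ∀ x : Fin d → ℤ, (∀ i, 0 < x i ∧ x i < N) → nbrAvg v x ≤ v x)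
    {F : Finset (Fin d → ℤ)} (hF : ∀ y ∈ F, ∀ i, 0 < y i ∧ y i < N) (hF1 : ∀ y ∈ F, 1 ≤ v y)
    (n : ℕ) : ∀ x : Fin d → ℤ, (∀ i, 0 ≤ x i ∧ x i ≤ N) →
      ∑ y ∈ F, lazyKernel N ε n x y ≤ v x := by
  induction n with
  | zero =>
    intro x hx
    by_cases hxi : ∀ i, 0 < x i ∧ x i < N
    · rw [Finset.sum_congr rfl fun y hy => lazyKernel_zero hxi (hF y hy), Finset.sum_ite_eq]
      split_ifs with h
      exacts [hF1 x h, hv0 x]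
    · push Not at hxi
      obtain ⟨i, hi⟩ := hxi
      have := hx i
      rw [Finset.sum_eq_zero fun y _ => lazyKernel_boundary hN ε 0 y (i := i) (by omega)]
      exact hv0 x
  | succ n ih =>
    intro x hx
    by_cases hxi : ∀ i, 0 < x i ∧ x i < N
    · simp only [lazyKernel_succ, Finset.sum_add_distrib, ← Finset.mul_sum]
      rw [← nbrAvg_sum]
      have h2 : nbrAvg (fun x => ∑ y ∈ F, lazyKernel N ε n x y) x ≤ nbrAvg v x :=
        nbrAvg_le_nbrAvg fun e he => ih _ fun i => by
          have := hxi i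
          have := abs_le.1 (he.abs_le i)
          simp only [Pi.add_apply]
          omega
      have h3 := mul_le_mul_of_nonneg_left (h2.trans (hv x hxi)) h0
      have h4 := mul_le_mul_of_nonneg_left (ih x hx) (sub_nonneg.2 h1)
      linarith
    · push Not at hxi
      obtain ⟨i, hi⟩ := hxi
      have := hx i
      rw [Finset.sum_eq_zero fun y _ => lazyKernel_boundary hN ε (n + 1) y (i := i) (by omega)]
      exact hv0 x

/-- The heat kernel on `{1, …, N - 1}` with absorption at `0` and `N`, at time `N²`. -/
noncomputable def intervalKernel (N : ℕ) (a b : ℤ) : ℝ :=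
  ∑ k ∈ Finset.range N, Real.exp (-(N ^ 2 * (1 - Real.cos (k * (Real.pi / N))))) *
    (2 / N * (Real.sin (k * (Real.pi * b / N)) * Real.sin (k * (Real.pi * a / N))))

/-- In continuous time the coordinates of the walk are independent, so that the kernel is a
product. -/
theorem tendsto_lazyKernel (hd : 0 < d) (N : ℕ) (x y : Fin d → ℤ) :
    Tendsto (fun n : ℕ => lazyKernel N (d * N ^ 2 / n : ℝ) n x y) atTop
      (𝓝 (∏ i, intervalKernel N (x i) (y i))) := by
  have hd' : (d : ℝ) ≠ 0 := by positivity
  have h1 : ∏ i, intervalKernel N (x i) (y i)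
      = ∑ κ ∈ Fintype.piFinset fun _ : Fin d => Finset.range N,
        Real.exp (-(d * N ^ 2) * sineGap d N κ) * ((2 / N) ^ d * sineProd N κ y)
          * sineProd N κ x := by
    simp only [intervalKernel]
    rw [Finset.prod_univ_sum]
    refine Finset.sum_congr rfl fun κ _ => ?_
    have h2 : -((d : ℝ) * N ^ 2) * sineGap d N κ
        = ∑ i, -((N : ℝ) ^ 2 * (1 - Real.cos (κ i * (Real.pi / N)))) := by
      rw [sineGap, Finset.sum_neg_distrib, ← Finset.mul_sum, Finset.sum_sub_distrib]
      simp only [Finset.sum_const, Finset.card_univ, Fintype.card_fin, nsmul_eq_mul, mul_one]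
      generalize ∑ i, Real.cos (κ i * (Real.pi / N)) = S
      field_simp
    rw [h2, Real.exp_sum]
    simp only [sineProd, Finset.prod_mul_distrib, Finset.prod_const,
      Finset.card_univ, Fintype.card_fin]
    ring
  rw [h1]
  unfold lazyKernel
  refine tendsto_finsetSum _ fun κ _ => ((?_ : Tendsto _ _ _).mul_const _).mul_const _
  have h3 := Real.tendsto_one_add_div_pow_exp (-(d * N ^ 2) * sineGap d N κ)
  refine h3.congr fun n => ?_
  ring

theorem intervalKernel_lower {N : ℕ} (hN : 2 ≤ N) {a b : ℤ} (ha : (N : ℤ) ≤ 4 * a)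
    (ha' : 4 * a ≤ 3 * N) (hb : (N : ℤ) ≤ 4 * b) (hb' : 4 * b ≤ 3 * N) :
    Real.exp (-5) / (2 * N) ≤ intervalKernel N a b := by
  have hN0 : (0 : ℝ) < N := by positivity
  have hpi := Real.pi_pos
  have hsin : ∀ c : ℤ, (N : ℤ) ≤ 4 * c → 4 * c ≤ 3 * N →
      Real.sqrt 2 / 2 ≤ Real.sin (Real.pi * c / N) := fun c h1 h2 => by
    have h1' : (N : ℝ) ≤ 4 * c := by exact_mod_cast h1
    have h2' : (4 : ℝ) * c ≤ 3 * N := by exact_mod_cast h2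
    have h3 : Real.pi / 4 ≤ Real.pi * c / N := by
      rw [div_le_div_iff₀ (by norm_num) hN0]; nlinarith
    have h4 : Real.pi * c / N ≤ 3 * Real.pi / 4 := by
      rw [div_le_div_iff₀ hN0 (by norm_num)]; nlinarith
    rw [← Real.cos_pi_div_four, ← Real.cos_pi_div_two_sub,
      ← Real.cos_abs (Real.pi / 2 - Real.pi * c / N)]
    refine Real.cos_le_cos_of_nonneg_of_le_pi (abs_nonneg _) (by linarith) (abs_le.2 ⟨?_, ?_⟩) <;>
    linarith
  obtain ⟨n, rfl⟩ : ∃ n, N = n + 2 := ⟨N - 2, by omega⟩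
  set N := n + 2 with hNdef
  let t : ℕ → ℝ := fun k => Real.exp (-(N ^ 2 * (1 - Real.cos (k * (Real.pi / N))))) *
    (Real.sin (k * (Real.pi * b / N)) * Real.sin (k * (Real.pi * a / N)))
  have h0 : intervalKernel N a b = 2 / N * ∑ k ∈ Finset.range N, t k := by
    rw [intervalKernel, Finset.mul_sum]
    exact Finset.sum_congr rfl fun k _ => by simp only [t]; ring
  have hsum : ∑ k ∈ Finset.range N, t k = ∑ k ∈ Finset.range n, t (k + 2) + t 1 := by
    rw [hNdef, Finset.sum_range_succ', Finset.sum_range_succ']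
    have : t 0 = 0 := by simp [t]
    rw [this, add_zero]
  -- the leading mode
  have ht1 : Real.exp (-5) / 2 ≤ t 1 := by
    have hc : (N : ℝ) ^ 2 * (1 - Real.cos ((1 : ℕ) * (Real.pi / N))) ≤ 5 := by
      have h1 := Real.one_sub_sq_div_two_le_cos (x := (1 : ℕ) * (Real.pi / N))
      have h2 : (N : ℝ) ^ 2 * (1 - Real.cos ((1 : ℕ) * (Real.pi / N))) ≤
          N ^ 2 * (((1 : ℕ) * (Real.pi / N)) ^ 2 / 2) := by gcongr; linarith
      have h3 : (N : ℝ) ^ 2 * (((1 : ℕ) * (Real.pi / N)) ^ 2 / 2) = Real.pi ^ 2 / 2 := by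
        push_cast; field_simp
      have h4 := Real.pi_lt_d2
      nlinarith
    have h5 : (1 : ℝ) / 2 ≤ Real.sin ((1 : ℕ) * (Real.pi * b / N))
        * Real.sin ((1 : ℕ) * (Real.pi * a / N)) := by
      have hb1 := hsin b hb hb'
      have ha1 := hsin a ha ha'
      have h6 : Real.sqrt 2 / 2 * (Real.sqrt 2 / 2) = 1 / 2 := by
        have := Real.mul_self_sqrt (show (0 : ℝ) ≤ 2 by norm_num)
        nlinarith
      rw [Nat.cast_one, one_mul, one_mul, ← h6]
      exact mul_le_mul hb1 ha1 (by positivity) (le_trans (by positivity) hb1)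
    calc Real.exp (-5) / 2 = Real.exp (-5) * (1 / 2) := by ring
      _ ≤ t 1 := mul_le_mul (Real.exp_le_exp.2 (neg_le_neg hc)) h5 (by norm_num)
          (Real.exp_pos _).le
  -- all the others decay at least geometrically
  have htk : ∀ k ∈ Finset.range n, -(Real.exp (-8) * (1 / 2) ^ k) ≤ t (k + 2) := fun k hk => by
    have hk' : k < n := Finset.mem_range.1 hk
    set θ : ℝ := ((k + 2 : ℕ) : ℝ) * (Real.pi / N) with hθ
    have hθ0 : 0 ≤ θ := by positivity
    have hθpi : θ ≤ Real.pi := by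
      rw [hθ, ← mul_div_assoc, div_le_iff₀ hN0, mul_comm]
      have : ((k + 2 : ℕ) : ℝ) ≤ N := by exact_mod_cast (by omega : k + 2 ≤ N)
      gcongr
    have hcos := Real.cos_le_one_sub_mul_cos_sq (x := θ) (by rwa [abs_of_nonneg hθ0])
    have hexp : (8 : ℝ) + k ≤ N ^ 2 * (1 - Real.cos θ) := by
      have h1 : (2 / Real.pi ^ 2) * θ ^ 2 ≤ 1 - Real.cos θ := by linarith
      have h2 : (N : ℝ) ^ 2 * ((2 / Real.pi ^ 2) * θ ^ 2) = 2 * ((k : ℝ) + 2) ^ 2 := by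
        rw [hθ]; push_cast; field_simp
      have h3 : (N : ℝ) ^ 2 * ((2 / Real.pi ^ 2) * θ ^ 2) ≤ N ^ 2 * (1 - Real.cos θ) := by gcongr
      have h4 : (0 : ℝ) ≤ k := k.cast_nonneg
      nlinarith
    have habs : |Real.sin ((k + 2 : ℕ) * (Real.pi * b / N))
        * Real.sin ((k + 2 : ℕ) * (Real.pi * a / N))| ≤ 1 := by
      rw [abs_mul]
      exact mul_le_one₀ (Real.abs_sin_le_one _) (abs_nonneg _) (Real.abs_sin_le_one _)
    have h5 : Real.exp (-(N ^ 2 * (1 - Real.cos θ))) ≤ Real.exp (-8) * (1 / 2) ^ k := by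
      have h6 : Real.exp (-1) ≤ 1 / 2 := by
        rw [Real.exp_neg, one_div]
        have := Real.add_one_le_exp 1
        gcongr
        linarith
      calc Real.exp (-(N ^ 2 * (1 - Real.cos θ))) ≤ Real.exp (-8 + k * (-1)) :=
            Real.exp_le_exp.2 (by linarith)
        _ = Real.exp (-8) * Real.exp (-1) ^ k := by rw [Real.exp_add, Real.exp_nat_mul]
        _ ≤ _ := by gcongr
    refine (neg_le_neg h5).trans ?_
    have h7 := (abs_le.1 habs).1
    have h8 := Real.exp_pos (-((N : ℝ) ^ 2 * (1 - Real.cos θ)))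
    calc -Real.exp (-((N : ℝ) ^ 2 * (1 - Real.cos θ)))
        = Real.exp (-((N : ℝ) ^ 2 * (1 - Real.cos θ))) * (-1) := by ring
      _ ≤ t (k + 2) := mul_le_mul_of_nonneg_left h7 h8.le
  have htail : -(2 * Real.exp (-8)) ≤ ∑ k ∈ Finset.range n, t (k + 2) := by
    refine le_trans ?_ (Finset.sum_le_sum htk)
    rw [Finset.sum_neg_distrib, ← Finset.mul_sum]
    have : ∑ k ∈ Finset.range n, (1 / 2 : ℝ) ^ k ≤ 2 := by
      have := geom_sum_eq (show (1 / 2 : ℝ) ≠ 1 by norm_num) n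
      have h9 : (0 : ℝ) ≤ (1 / 2) ^ n := by positivity
      rw [this, div_le_iff_of_neg (by norm_num)]
      linarith
    have h10 := mul_le_mul_of_nonneg_left this (Real.exp_pos (-8)).le
    linarith
  have hfin : Real.exp (-5) / 4 ≤ ∑ k ∈ Finset.range N, t k := by
    rw [hsum]
    have h11 : 8 * Real.exp (-8) ≤ Real.exp (-5) := by
      have h12 : Real.exp (-5) = Real.exp 1 ^ 3 * Real.exp (-8) := by
        rw [← Real.exp_nat_mul, ← Real.exp_add]; norm_num
      have h13 : (2 : ℝ) ≤ Real.exp 1 := by linarith [Real.add_one_le_exp 1]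
      rw [h12]
      have : (2 : ℝ) ^ 3 ≤ Real.exp 1 ^ 3 := by gcongr
      have := Real.exp_pos (-8)
      nlinarith
    linarith
  rw [h0]
  calc Real.exp (-5) / (2 * N) = 2 / N * (Real.exp (-5) / 4) := by field_simp; norm_num
    _ ≤ _ := by gcongr

/-- The constant in the lower bound `mul_hitConst_le` on hitting probabilities. -/
noncomputable def hitConst (d : ℕ) : ℝ := (Real.exp (-5) / 4) ^ d

theorem hitConst_pos (d : ℕ) : 0 < hitConst d := by unfold hitConst; positivity

theorem hitConst_le_one (d : ℕ) : hitConst d ≤ 1 := by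
  refine pow_le_one₀ (by positivity) ?_
  have : Real.exp (-5) ≤ 1 := Real.exp_le_one_iff.2 (by norm_num)
  linarith

/-- A set of relative volume `δ` in the ball of radius `R` around `z` is hit, from any point of that
ball and before the ball of radius `2 R` is left, with probability at least `δ * hitConst d`. In
analytic terms: a supersolution `v ≥ 0` with `v ≥ 1` on the set is at least that large. -/
theorem mul_hitConst_le (hd : 0 < d) {R : ℕ} (hR : 0 < R) (z : Fin d → ℤ)
    {v : (Fin d → ℤ) → ℝ} (hv0 : ∀ x, 0 ≤ v x)
    (hv : ∀ x : Fin d → ℤ, (∀ i, |x i - z i| < 2 * R) → nbrAvg v x ≤ v x)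
    {F : Finset (Fin d → ℤ)} (hF : ∀ y ∈ F, ∀ i, |y i - z i| ≤ R) (hF1 : ∀ y ∈ F, 1 ≤ v y)
    {δ : ℝ} (hδ : δ * (2 * R + 1) ^ d ≤ F.card) (hδ0 : 0 ≤ δ) {x : Fin d → ℤ}
    (hx : ∀ i, |x i - z i| ≤ R) :
    δ * hitConst d ≤ v x := by
  classical
  set N : ℕ := 4 * R with hN
  let a : Fin d → ℤ := fun i => z i - 2 * R
  have hR' : (0 : ℝ) < R := by positivity
  let F' : Finset (Fin d → ℤ) := F.image fun y => y - a
  have hmain : ∀ n : ℕ, (d * N ^ 2 : ℝ) ≤ n → 0 < n →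
      ∑ y ∈ F', lazyKernel N (d * N ^ 2 / n : ℝ) n (x - a) y ≤ v x := by
    intro n hn hn0
    have hn0' : (0 : ℝ) < n := by positivity
    have h := sum_lazyKernel_le (N := N) (by omega) (ε := (d * N ^ 2 / n : ℝ)) (by positivity)
      ((div_le_one hn0').2 hn) (v := fun x => v (a + x)) (fun x => hv0 _)
      (fun x hx => by
        rw [nbrAvg_comp_add]
        refine hv _ fun i => ?_
        have := hx i
        simp only [Pi.add_apply, a, abs_lt]
        omega)
      (F := F')
      (fun y hy i => by
        obtain ⟨w, hw, rfl⟩ := Finset.mem_image.1 hy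
        have := abs_le.1 (hF w hw i)
        simp only [Pi.sub_apply, a]
        omega)
      (fun y hy => by
        obtain ⟨w, hw, rfl⟩ := Finset.mem_image.1 hy
        simpa using hF1 w hw) n (x - a)
      (fun i => by
        have := abs_le.1 (hx i)
        simp only [Pi.sub_apply, a]
        omega)
    simpa using h
  have hlim : Tendsto (fun n : ℕ => ∑ y ∈ F', lazyKernel N (d * N ^ 2 / n : ℝ) n (x - a) y) atTop
      (𝓝 (∑ y ∈ F', ∏ i, intervalKernel N ((x - a) i) (y i))) :=
    tendsto_finsetSum _ fun y _ => tendsto_lazyKernel hd N (x - a) y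
  have hle : ∑ y ∈ F', ∏ i, intervalKernel N ((x - a) i) (y i) ≤ v x := by
    refine le_of_tendsto hlim ?_
    filter_upwards [(tendsto_natCast_atTop_atTop (R := ℝ)).eventually_ge_atTop (d * N ^ 2 : ℝ),
      eventually_gt_atTop 0] with n h1 h2 using hmain n h1 h2
  refine le_trans ?_ hle
  have hcard : F'.card = F.card := Finset.card_image_of_injective _ sub_left_injective
  have hlow : ∀ y ∈ F', (Real.exp (-5) / (2 * N)) ^ d ≤
      ∏ i, intervalKernel N ((x - a) i) (y i) := fun y hy => by
    obtain ⟨w, hw, rfl⟩ := Finset.mem_image.1 hy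
    have hc : (Real.exp (-5) / (2 * N)) ^ d = ∏ _i : Fin d, (Real.exp (-5) / (2 * (N : ℝ))) := by
      rw [Finset.prod_const, Finset.card_univ, Fintype.card_fin]
    rw [hc]
    refine Finset.prod_le_prod (fun i _ => by positivity) fun i _ => ?_
    have h1 := abs_le.1 (hx i)
    have h2 := abs_le.1 (hF w hw i)
    refine intervalKernel_lower (by omega) ?_ ?_ ?_ ?_ <;> simp only [Pi.sub_apply, a, hN] <;>
      push_cast <;> omega
  have h1 : (F.card : ℝ) * (Real.exp (-5) / (2 * N)) ^ d
      ≤ ∑ y ∈ F', ∏ i, intervalKernel N ((x - a) i) (y i) := by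
    rw [← hcard, ← nsmul_eq_mul]
    exact Finset.card_nsmul_le_sum _ _ _ hlow
  refine le_trans ?_ h1
  calc δ * hitConst d = δ * (2 * R) ^ d * (Real.exp (-5) / (2 * N)) ^ d := by
        rw [hitConst, mul_assoc, ← mul_pow]
        congr 2
        rw [hN]
        push_cast
        field_simp
    _ ≤ δ * (2 * R + 1) ^ d * (Real.exp (-5) / (2 * N)) ^ d := by gcongr; linarith
    _ ≤ _ := by gcongr

/-! ### Relative volumes in balls -/

/-- The ball of integer radius `r` around `x`, as a finite set. -/
noncomputable def box (x : Fin d → ℤ) (r : ℕ) : Finset (Fin d → ℤ) :=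
  Finset.Icc (fun i => x i - r) (fun i => x i + r)

theorem mem_box {x y : Fin d → ℤ} {r : ℕ} : y ∈ box x r ↔ ∀ i, |y i - x i| ≤ r := by
  simp only [box, Finset.mem_Icc, Pi.le_def, ← forall_and, abs_le]
  exact forall_congr' fun i => by omega

theorem mem_box_iff_norm {x y : Fin d → ℤ} {r : ℕ} : y ∈ box x r ↔ ‖y - x‖ ≤ r := by
  rw [mem_box, pi_norm_le_iff_of_nonneg (Nat.cast_nonneg r)]
  refine forall_congr' fun i => ?_
  rw [Int.norm_eq_abs, Pi.sub_apply, ← Int.cast_natCast (R := ℝ), ← Int.cast_abs, Int.cast_le]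

theorem coe_box (x : Fin d → ℤ) (r : ℕ) : (box x r : Set (Fin d → ℤ)) = ball x (r : ℝ) := by
  ext y
  rw [Finset.mem_coe, mem_box_iff_norm, Metric.mem_closedBall, dist_eq_norm]

theorem mem_box_comm {x y : Fin d → ℤ} {r : ℕ} : y ∈ box x r ↔ x ∈ box y r := by
  rw [mem_box_iff_norm, mem_box_iff_norm, norm_sub_rev]

theorem box_subset_box {x y : Fin d → ℤ} {r s : ℕ} (h : ‖x - y‖ + r ≤ s) :
    box x r ⊆ box y s := fun w hw => by
  rw [mem_box_iff_norm] at hw ⊢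
  have := norm_add_le (w - x) (x - y)
  rw [sub_add_sub_cancel] at this
  linarith

theorem card_box (x : Fin d → ℤ) (r : ℕ) : (box x r).card = (2 * r + 1) ^ d := by
  rw [box, Pi.card_Icc]
  simp only [Int.card_Icc]
  rw [Finset.prod_congr rfl fun i _ => show (x i + r + 1 - (x i - r)).toNat = 2 * r + 1 by omega]
  simp

theorem density_eq (U : Set (Fin d → ℤ)) [DecidablePred (· ∈ U)] (x : Fin d → ℤ) (r : ℕ) :
    density U x r = ((box x r).filter (· ∈ U)).card / (2 * r + 1 : ℝ) ^ d := by
  have h1 : ball x (r : ℝ) ∩ U = ((box x r).filter (· ∈ U) : Finset _) := by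
    rw [Finset.coe_filter, ← coe_box]; rfl
  rw [density, h1, ← coe_box, Set.ncard_coe_finset, Set.ncard_coe_finset, card_box]
  push_cast
  rfl

theorem density_nonneg (U : Set (Fin d → ℤ)) (x : Fin d → ℤ) (r : ℝ) : 0 ≤ density U x r := by
  unfold density; positivity

theorem density_compl (U : Set (Fin d → ℤ)) (x : Fin d → ℤ) (r : ℕ) :
    density Uᶜ x r = 1 - density U x r := by
  classical
  rw [density_eq, density_eq, eq_sub_iff_add_eq', ← add_div, div_eq_one_iff_eq (by positivity)]
  have := Finset.card_filter_add_card_filter_not (s := box x r) (· ∈ U)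
  rw [card_box] at this
  simp only [Set.mem_compl_iff]
  exact_mod_cast this

theorem density_le_one (U : Set (Fin d → ℤ)) (x : Fin d → ℤ) (r : ℕ) : density U x r ≤ 1 := by
  have h1 := density_compl U x r
  have h2 := density_nonneg Uᶜ x r
  linarith

/-- A ball loses only a small fraction of its volume when its radius is slightly reduced. -/
theorem one_sub_mul_pow_le {r s : ℕ} (hs : s ≤ r) (hr : 0 < r) (d : ℕ) :
    (1 - d * (s / r : ℝ)) * (2 * r + 1) ^ d ≤ (2 * (r - s : ℕ) + 1 : ℝ) ^ d := by
  have hr' : (0 : ℝ) < r := by positivity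
  have hs' : (s : ℝ) / r ≤ 1 := (div_le_one hr').2 (by exact_mod_cast hs)
  have hs0 : (0 : ℝ) ≤ s / r := by positivity
  have h1 : 1 - d * (s / r : ℝ) ≤ (1 - s / r : ℝ) ^ d := by
    have := one_add_mul_le_pow (a := -(s / r : ℝ)) (by linarith) d
    rw [← sub_eq_add_neg] at this
    linarith
  calc (1 - d * (s / r : ℝ)) * (2 * r + 1) ^ d
      ≤ (1 - s / r : ℝ) ^ d * (2 * r + 1) ^ d := by gcongr
    _ = ((1 - s / r : ℝ) * (2 * r + 1)) ^ d := (mul_pow _ _ _).symm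
    _ ≤ _ := by
      refine pow_le_pow_left₀ (mul_nonneg (by linarith) (by positivity)) ?_ d
      rw [Nat.cast_sub hs]
      have : (1 - s / r : ℝ) * (2 * r + 1) = 2 * (r - s) + 1 - s / r := by field_simp; ring
      linarith

theorem le_card_inner (U : Set (Fin d → ℤ)) [DecidablePred (· ∈ U)] (x : Fin d → ℤ) {r s : ℕ}
    (hs : s ≤ r) (hr : 0 < r) :
    (density U x r - d * (s / r : ℝ)) * (2 * r + 1) ^ d
      ≤ ((box x (r - s)).filter (· ∈ U)).card := by
  have hsub : box x (r - s) ⊆ box x r := box_subset_box (by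
    simp only [sub_self, norm_zero, zero_add, Nat.cast_le]; omega)
  have h1 : ((box x r).filter (· ∈ U)).card ≤
      ((box x (r - s)).filter (· ∈ U)).card + (box x r \ box x (r - s)).card := by
    rw [← Nat.sub_le_iff_le_add]
    refine (Nat.sub_le_iff_le_add.2 ?_)
    refine (Finset.card_le_card (t := (box x (r - s)).filter (· ∈ U) ∪ (box x r \ box x (r - s)))
      fun w hw => ?_).trans (Finset.card_union_le _ _)
    rw [Finset.mem_filter] at hw
    rw [Finset.mem_union, Finset.mem_filter, Finset.mem_sdiff]
    tauto
  have h2 : ((box x r \ box x (r - s)).card : ℝ)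
      = (2 * r + 1) ^ d - (2 * (r - s : ℕ) + 1) ^ d := by
    have := Finset.card_sdiff_add_card_eq_card hsub
    rw [card_box, card_box] at this
    rw [eq_sub_iff_add_eq]
    exact_mod_cast this
  have h3 := one_sub_mul_pow_le hs hr d
  have h4 : density U x r * (2 * r + 1) ^ d = ((box x r).filter (· ∈ U)).card := by
    rw [density_eq]; field_simp
  have h5 : (((box x r).filter (· ∈ U)).card : ℝ) ≤
      ((box x (r - s)).filter (· ∈ U)).card + (box x r \ box x (r - s)).card := by
    exact_mod_cast h1
  linarith

/-- The relative volume of a set in a ball varies slowly with the centre of the ball. -/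
theorem density_sub_le (U : Set (Fin d → ℤ)) {x y : Fin d → ℤ} {r s : ℕ} (hs : s ≤ r)
    (hr : 0 < r) (hxy : ‖x - y‖ ≤ s) : density U x r - d * (s / r : ℝ) ≤ density U y r := by
  classical
  rw [density_eq U y, le_div_iff₀ (by positivity)]
  refine (le_card_inner U x hs hr).trans (Nat.cast_le.2 (Finset.card_le_card
    (Finset.filter_subset_filter _ (box_subset_box ?_))))
  rw [Nat.cast_sub hs]
  linarith

theorem density_step (U : Set (Fin d → ℤ)) {x e : Fin d → ℤ} (he : IsStep e) {r : ℕ}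
    (hr : 13 * d ≤ r) (hr0 : 0 < r) : |density U (x + e) r - density U x r| ≤ 1 / 13 := by
  have hr0' : (0 : ℝ) < r := by positivity
  have hb : (d : ℝ) * ((1 : ℕ) / r : ℝ) ≤ 1 / 13 := by
    rw [Nat.cast_one, mul_one_div, div_le_div_iff₀ hr0' (by norm_num)]
    have : (13 : ℝ) * d ≤ r := by exact_mod_cast hr
    linarith
  have h1 := density_sub_le U (x := x) (y := x + e) (s := 1) hr0 hr0 (by
    rw [sub_add_cancel_left, norm_neg]; exact_mod_cast he.norm_le)
  have h2 := density_sub_le U (x := x + e) (y := x) (s := 1) hr0 hr0 (by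
    rw [add_sub_cancel_left]; exact_mod_cast he.norm_le)
  rw [abs_le]
  constructor <;> linarith

theorem mul_card_inner_le (U : Set (Fin d → ℤ)) [DecidablePred (· ∈ U)] (y : Fin d → ℤ)
    {r R : ℕ} (hr : r ≤ R) :
    (2 * r + 1) ^ d * ((box y (R - r)).filter (· ∈ U)).card
      ≤ ∑ w ∈ box y R, ((box w r).filter (· ∈ U)).card := by
  set T := (box y (R - r)).filter (· ∈ U) with hT
  calc (2 * r + 1) ^ d * T.card = ∑ u ∈ T, ((box y R).filter fun w => w ∈ box u r).card := by
        rw [Finset.sum_congr rfl (g := fun _ => (2 * r + 1) ^ d) fun u hu => ?_,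
          Finset.sum_const, smul_eq_mul, mul_comm]
        have hu' := mem_box_iff_norm.1 (Finset.mem_filter.1 hu).1
        rw [Nat.cast_sub hr] at hu'
        rw [Finset.filter_mem_eq_inter, Finset.inter_eq_right.2 (box_subset_box (by linarith)),
          card_box]
    _ = ∑ w ∈ box y R, (T.filter fun u => w ∈ box u r).card := by
        simp only [Finset.card_filter]
        exact Finset.sum_comm
    _ ≤ _ := by
        refine Finset.sum_le_sum fun w _ => Finset.card_le_card fun u hu => ?_
        rw [Finset.mem_filter, hT, Finset.mem_filter] at hu
        exact Finset.mem_filter.2 ⟨mem_box_comm.1 hu.2, hu.1.2⟩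

/-- The relative volume at a large scale is nearly the average of the relative volumes at a small
scale, so that the latter cannot be small at almost all points. -/
theorem le_card_density_ge (U : Set (Fin d → ℤ)) (y : Fin d → ℤ) {r R : ℕ} (hr : r ≤ R)
    (hR : 0 < R) {s : ℝ} (hs : 0 ≤ s) [DecidablePred fun w => s ≤ density U w r] :
    (density U y R - d * (r / R : ℝ) - s) * (2 * R + 1) ^ d
      ≤ ((box y R).filter fun w => s ≤ density U w r).card := by
  classical
  have h1 := le_card_inner U y hr hR
  have h2 : (((box y (R - r)).filter (· ∈ U)).card : ℝ) ≤ ∑ w ∈ box y R, density U w r := by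
    have := mul_card_inner_le U y hr
    simp only [density_eq, ← Finset.sum_div]
    rw [le_div_iff₀ (by positivity), mul_comm]
    exact_mod_cast this
  have h3 : ∑ w ∈ box y R, density U w r
      ≤ ∑ w ∈ box y R, ((if s ≤ density U w r then 1 else 0) + s) := by
    refine Finset.sum_le_sum fun w _ => ?_
    split_ifs with h
    · linarith [density_le_one U w r]
    · linarith
  rw [Finset.sum_add_distrib, Finset.sum_boole, Finset.sum_const, card_box, nsmul_eq_mul] at h3
  push_cast at h3
  linarith

/-- A ball of radius `4 R` whose centre is within `3 R` of `w` contains the ball of radius `R`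
around `w`, and hence inherits a fraction `4 ^ (-d)` of its relative volume. -/
theorem alphaTilde_le_density (U : Set (Fin d → ℤ)) {w y : Fin d → ℤ} {R : ℕ}
    (h : 1 / 3 ≤ density U w R) (hy : ‖y - w‖ ≤ 3 * R) :
    alphaTilde d ≤ density U y (4 * R : ℕ) := by
  classical
  have hsub : box w R ⊆ box y (4 * R) := box_subset_box (by
    rw [norm_sub_rev]; push_cast; linarith)
  have h1 : (((box w R).filter (· ∈ U)).card : ℝ) ≤ ((box y (4 * R)).filter (· ∈ U)).card :=
    Nat.cast_le.2 (Finset.card_le_card (Finset.filter_subset_filter _ hsub))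
  rw [density_eq, le_div_iff₀ (by positivity)] at h
  rw [density_eq, le_div_iff₀ (by positivity)]
  refine le_trans ?_ (h.trans h1)
  rw [alphaTilde, mul_assoc, ← inv_pow, ← mul_pow]
  gcongr
  push_cast
  linarith

theorem density_mem_Icc_alphaTilde (U : Set (Fin d → ℤ)) {w y : Fin d → ℤ} {R : ℕ}
    (h : density U w R ∈ Set.Icc (1 / 3 : ℝ) (2 / 3)) (hy : ‖y - w‖ ≤ 3 * R) :
    density U y (4 * R : ℕ) ∈ Set.Icc (alphaTilde d) (1 - alphaTilde d) := by
  refine ⟨alphaTilde_le_density U h.1 hy, ?_⟩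
  have h1 := alphaTilde_le_density Uᶜ (w := w) (y := y) (R := R) (by
    rw [density_compl]; linarith [h.2]) hy
  rw [density_compl] at h1
  linarith

theorem finite_density_compl_le_half (U₀ : Finset (Fin d → ℤ)) (r : ℕ) :
    {x : Fin d → ℤ | density (U₀ : Set (Fin d → ℤ))ᶜ x r ≤ 1 / 2}.Finite := by
  classical
  refine (U₀.biUnion fun u => box u r).finite_toSet.subset fun x hx => ?_
  rw [Set.mem_ofPred_eq, density_compl] at hx
  by_contra hcon
  have h0 : density (U₀ : Set (Fin d → ℤ)) x r = 0 := by
    rw [density_eq, Finset.filter_eq_empty_iff.2]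
    · simp
    · intro w hw hwU
      exact hcon (Finset.mem_coe.2 (Finset.mem_biUnion.2 ⟨w, hwU, mem_box_comm.1 hw⟩))
  rw [h0] at hx
  norm_num at hx

/-! ### Descending through the scales -/

/-- A walk started at a point of low relative volume at scale `r` has to visit points of
intermediate relative volume before it reaches points of high relative volume, because the relative
volume changes little in each step; and the latter points are not rare if the relative volume at
the larger scale `R` is not low. -/
theorem mul_hitConst_le_of_density_lt (hd : 0 < d) (U : Set (Fin d → ℤ)) {r R : ℕ}
    (hr : 13 * d ≤ r) (hr0 : 0 < r) (hrR : r ≤ R) {a a' δ : ℝ} (hδ0 : 0 ≤ δ)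
    (hδ : a + δ + d * (r / R : ℝ) ≤ a') (ha' : 1 / 26 ≤ a') (ha2 : a' ≤ 1 / 2)
    {y : Fin d → ℤ} (hy : 1 / 2 - a ≤ density U y R) (hylow : density U y r < 1 / 2 - a')
    {v : (Fin d → ℤ) → ℝ} (hv0 : ∀ x, 0 ≤ v x)
    (hv : ∀ x : Fin d → ℤ, ‖x - y‖ ≤ 2 * R → nbrAvg v x ≤ v x)
    (hv1 : ∀ w : Fin d → ℤ, ‖w - y‖ ≤ 2 * R →
      density U w r ∈ Set.Icc (1 / 2 - a') (1 / 2 + a') → 1 ≤ v w) :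
    δ * hitConst d ≤ v y := by
  classical
  have hR : 0 < R := hr0.trans_le hrR
  have hbox : ∀ {x : Fin d → ℤ} {n : ℕ}, (∀ i, |x i - y i| ≤ n) → ‖x - y‖ ≤ n := fun h =>
    mem_box_iff_norm.1 (mem_box.2 h)
  let v₁ : (Fin d → ℤ) → ℝ := fun w => if density U w r < 1 / 2 - a' then min (v w) 1 else 1
  have hv₁y : v₁ y ≤ v y := by
    simp only [v₁, if_pos hylow]
    exact min_le_left _ _
  refine le_trans ?_ hv₁y
  refine mul_hitConst_le hd hR y (v := v₁)
    (F := (box y R).filter fun w => 1 / 2 - a' ≤ density U w r) (fun x => ?_) (fun x hx => ?_)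
    (fun w hw => ?_) (fun w hw => ?_) ?_ hδ0 (fun i => by simp)
  · simp only [v₁]
    split_ifs
    exacts [le_min (hv0 x) zero_le_one, zero_le_one]
  · have hx1 : ‖x - y‖ ≤ 2 * R := by
      have := hbox (x := x) (n := 2 * R) fun i => by
        have := hx i
        push_cast
        omega
      exact_mod_cast this
    have hmin : ∀ w, v₁ w ≤ 1 := fun w => by
      simp only [v₁]; split_ifs
      exacts [min_le_right _ _, le_rfl]
    by_cases hlow : density U x r < 1 / 2 - a'
    · have hx2 : v₁ x = min (v x) 1 := by simp only [v₁, if_pos hlow]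
      rw [hx2]
      refine le_min (le_trans ?_ (hv x hx1)) ?_
      · refine nbrAvg_le_nbrAvg fun e he => ?_
        by_cases hlow' : density U (x + e) r < 1 / 2 - a'
        · simp only [v₁, if_pos hlow']
          exact min_le_left _ _
        · refine (hmin _).trans (hv1 _ ?_ ⟨not_lt.1 hlow', ?_⟩)
          · have := hbox (x := x + e) (n := 2 * R) fun i => by
              have h1 := abs_lt.1 (hx i)
              have h2 := abs_le.1 (he.abs_le i)
              simp only [Pi.add_apply, abs_le]
              push_cast
              omega
            exact_mod_cast this
          · have := (abs_le.1 (density_step U (x := x) he hr hr0)).2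
            linarith
      · exact (nbrAvg_le_nbrAvg fun e _ => hmin _).trans (nbrAvg_const hd 1 x).le
    · have hx2 : v₁ x = 1 := by simp only [v₁, if_neg hlow]
      rw [hx2]
      exact (nbrAvg_le_nbrAvg fun e _ => hmin _).trans (nbrAvg_const hd 1 x).le
  · exact mem_box.1 (Finset.mem_filter.1 hw).1
  · simp only [v₁, if_neg (not_lt.2 (Finset.mem_filter.1 hw).2), le_refl]
  · refine le_trans ?_ (le_card_density_ge U y hrR hR (s := 1 / 2 - a') (by linarith))
    gcongr
    linarith

/-- From a point of balanced relative volume at scale `R`, the walk has a uniformly positive chance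
to find a point of balanced relative volume at a smaller scale `r` before leaving the ball of
radius `2 R`. The ratio of the scales does not enter. -/
theorem mul_hitConst_le_of_density_mem (hd : 0 < d) (U : Set (Fin d → ℤ)) {r R : ℕ}
    (hr : 13 * d ≤ r) (hr0 : 0 < r) (hrR : r ≤ R) {a a' δ : ℝ} (hδ0 : 0 ≤ δ) (hδ1 : δ ≤ 1)
    (hδ : a + δ + d * (r / R : ℝ) ≤ a') (ha' : 1 / 26 ≤ a') (ha2 : a' ≤ 1 / 2)
    {y : Fin d → ℤ} (hy : density U y R ∈ Set.Icc (1 / 2 - a) (1 / 2 + a))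
    {v : (Fin d → ℤ) → ℝ} (hv0 : ∀ x, 0 ≤ v x)
    (hv : ∀ x : Fin d → ℤ, ‖x - y‖ ≤ 2 * R → nbrAvg v x ≤ v x)
    (hv1 : ∀ w : Fin d → ℤ, ‖w - y‖ ≤ 2 * R →
      density U w r ∈ Set.Icc (1 / 2 - a') (1 / 2 + a') → 1 ≤ v w) :
    δ * hitConst d ≤ v y := by
  rcases lt_or_ge (density U y r) (1 / 2 - a') with hlow | hlow
  · exact mul_hitConst_le_of_density_lt hd U hr hr0 hrR hδ0 hδ ha' ha2 hy.1 hlow hv0 hv hv1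
  rcases lt_or_ge (1 / 2 + a') (density U y r) with hhigh | hhigh
  · refine mul_hitConst_le_of_density_lt hd Uᶜ hr hr0 hrR hδ0 hδ ha' ha2 ?_ ?_ hv0 hv ?_
    · rw [density_compl]; linarith [hy.2]
    · rw [density_compl]; linarith
    · intro w hw hw'
      rw [density_compl] at hw'
      exact hv1 w hw ⟨by linarith [hw'.2], by linarith [hw'.1]⟩
  · have h1 := hv1 y (by simp) ⟨hlow, hhigh⟩
    exact (mul_le_one₀ hδ1 (hitConst_pos d).le (hitConst_le_one d)).trans h1

/-- The points that are close, relative to each of the scales `R 0, …, R J`, to points of balanced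
relative volume at that scale. -/
def balancedCore (U : Set (Fin d → ℤ)) (R : ℕ → ℕ) (J : ℕ) : Set (Fin d → ℤ) :=
  {y | ∀ j ≤ J, ∃ w, ‖y - w‖ ≤ 5 / 2 * R j ∧ density U w (R j) ∈ Set.Icc (1 / 3 : ℝ) (2 / 3)}

/-- Lower bound on the probability to descend by one scale. -/
noncomputable def descentProb (d J : ℕ) : ℝ := 1 / (24 * J) * hitConst d

theorem descentProb_pos (d : ℕ) {J : ℕ} (hJ : 1 ≤ J) : 0 < descentProb d J := by
  have : (0 : ℝ) < J := by exact_mod_cast hJ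
  have := hitConst_pos d
  unfold descentProb
  positivity

theorem descentProb_le_one (d : ℕ) {J : ℕ} (hJ : 1 ≤ J) : descentProb d J ≤ 1 := by
  have : (1 : ℝ) ≤ J := by exact_mod_cast hJ
  refine mul_le_one₀ ?_ (hitConst_pos d).le (hitConst_le_one d)
  rw [div_le_one (by positivity)]
  linarith

/-- A barrier at `z`: a function that dominates the probability of leaving the ball of radius `ρ`
around `z` before visiting `C`. -/
structure IsBarrier (C : Set (Fin d → ℤ)) (ρ : ℝ) (z : Fin d → ℤ) (g : (Fin d → ℤ) → ℝ) :
    Prop where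
  nonneg : ∀ x, 0 ≤ g x
  one_le : ∀ x, ρ < ‖x - z‖ → 1 ≤ g x
  nbrAvg_le : ∀ x, ‖x - z‖ ≤ ρ → x ∉ C → nbrAvg g x ≤ g x

/-- Starting from a point of balanced relative volume at the largest scale, the walk descends
through all scales with a probability that depends neither on the scales nor on the set. -/
theorem exists_isBarrier_balancedCore (hd : 0 < d) (U : Set (Fin d → ℤ)) {J : ℕ} (hJ : 1 ≤ J)
    {R : ℕ → ℕ} (hR : ∀ j ≤ J, 13 * d ≤ R j) (hR0 : ∀ j ≤ J, 0 < R j)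
    (hR1 : ∀ j < J, 32 * R (j + 1) ≤ R j)
    (hR2 : ∀ j < J, d * (R (j + 1) / R j : ℝ) ≤ 1 / (200 * J)) {z : Fin d → ℤ}
    (hz : density U z (R 0) ∈ Set.Icc (1 / 2 : ℝ) (1 / 2 + 1 / 13)) :
    ∃ g, IsBarrier (balancedCore U R J) (3 * R 0) z g ∧ g z ≤ 1 - descentProb d J ^ J := by
  have hJ0 : (0 : ℝ) < J := by exact_mod_cast hJ
  set η := descentProb d J with hη
  have hηpos : 0 < η := descentProb_pos d hJ
  set D : Set (Fin d → ℤ) := {x | ‖x - z‖ ≤ 3 * R 0}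
  obtain ⟨v, hv0, hv1, hvC, hvD, hvout⟩ :=
    exists_hitting_function hd (balancedCore U R J ∩ D) D
  have hsuper : ∀ x ∈ D, nbrAvg v x ≤ v x := fun x hx => by
    by_cases hxC : x ∈ balancedCore U R J ∩ D
    · rw [hvC x hxC]
      exact (nbrAvg_le_nbrAvg fun e _ => hv1 _).trans (nbrAvg_const hd 1 x).le
    · exact (hvD x ⟨hx, hxC⟩).ge
  -- the admissible window is slightly enlarged at each of the `J` descents
  let a : ℕ → ℝ := fun i => 1 / 12 + i / (12 * J)
  have ha_le : ∀ i ≤ J, a i ≤ 1 / 6 := fun i hi => by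
    have h1 : (i : ℝ) ≤ J := by exact_mod_cast hi
    have h2 : (i : ℝ) / (12 * J) ≤ 1 / 12 := by
      rw [div_le_div_iff₀ (by positivity) (by norm_num)]; linarith
    simp only [a]
    linarith
  have ha_ge : ∀ i, 1 / 12 ≤ a i := fun i => by
    have : (0 : ℝ) ≤ i / (12 * J) := by positivity
    simp only [a]
    linarith
  have hmain : ∀ n i, i + n = J → ∀ y : Fin d → ℤ,
      (∀ j ≤ i, ∃ w, ‖y - w‖ ≤ 5 / 2 * (R j - R i) ∧
        density U w (R j) ∈ Set.Icc (1 / 3 : ℝ) (2 / 3)) →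
      density U y (R i) ∈ Set.Icc (1 / 2 - a i) (1 / 2 + a i) →
      ‖y - z‖ ≤ 5 / 2 * (R 0 - R i) → η ^ n ≤ v y := by
    intro n
    induction n with
    | zero =>
      intro i hi y h1 h2 h3
      obtain rfl : i = J := by omega
      have hRi : (0 : ℝ) ≤ R i := by positivity
      refine (pow_zero η).trans_le (hvC y ⟨fun j hj => ?_, ?_⟩).ge
      · obtain ⟨w, hw, hw'⟩ := h1 j hj
        exact ⟨w, by linarith, hw'⟩
      · have : (0 : ℝ) ≤ R 0 := by positivity
        change ‖y - z‖ ≤ 3 * R 0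
        linarith
    | succ n ih =>
      intro i hi y h1 h2 h3
      have hRi : (0 : ℝ) ≤ R i := by positivity
      have hR0' : (0 : ℝ) ≤ R 0 := by positivity
      have h32 : (32 : ℝ) * R (i + 1) ≤ R i := by exact_mod_cast hR1 i (by omega)
      have hstep : η ≤ v y / η ^ n := by
        refine mul_hitConst_le_of_density_mem hd U (r := R (i + 1)) (R := R i)
          (hR _ (by omega)) (hR0 _ (by omega)) (by have := hR1 i (by omega); omega)
          (a := a i) (a' := a (i + 1)) (by positivity)
          ((div_le_one (by positivity)).2 (by
            have : (1 : ℝ) ≤ J := by exact_mod_cast hJ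
            linarith)) ?_
          (by linarith [ha_ge (i + 1)]) (by linarith [ha_le (i + 1) (by omega)]) h2
          (v := fun x => v x / η ^ n) (fun x => div_nonneg (hv0 x) (by positivity))
          (fun x hx => ?_) (fun w hw hw' => ?_)
        · have e1 : a (i + 1) = a i + 1 / (12 * J) := by
            simp only [a]; push_cast; ring
          have e2 : (1 : ℝ) / (24 * J) + 1 / (200 * J) ≤ 1 / (12 * J) := by
            have h5 : (1 : ℝ) / (24 * J) + 1 / (200 * J) = (1 / 24 + 1 / 200) * (1 / J) := by
              field_simp
            have h6 : (1 : ℝ) / (12 * J) = 1 / 12 * (1 / J) := by field_simp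
            rw [h5, h6]
            gcongr
            norm_num
          have := hR2 i (by omega)
          rw [e1]
          linarith
        · have e1 : (fun x => v x / η ^ n) = fun x => (η ^ n)⁻¹ * v x :=
            funext fun x => by ring
          rw [e1, nbrAvg_const_mul]
          change (η ^ n)⁻¹ * nbrAvg v x ≤ v x / η ^ n
          rw [div_eq_inv_mul]
          refine mul_le_mul_of_nonneg_left (hsuper x ?_) (by positivity)
          change ‖x - z‖ ≤ 3 * R 0
          have := norm_add_le (x - y) (y - z)
          rw [sub_add_sub_cancel] at this
          linarith
        · rw [le_div_iff₀ (by positivity), one_mul]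
          refine ih (i + 1) (by omega) w (fun j hj => ?_) hw' ?_
          · rcases Nat.lt_or_ge i j with h | h
            · obtain rfl : j = i + 1 := by omega
              refine ⟨w, by simp, ?_⟩
              have := ha_le (i + 1) (by omega)
              exact ⟨by linarith [hw'.1], by linarith [hw'.2]⟩
            · obtain ⟨w', hw1, hw2⟩ := h1 j h
              refine ⟨w', ?_, hw2⟩
              have := norm_add_le (w - y) (y - w')
              rw [sub_add_sub_cancel] at this
              linarith
          · have := norm_add_le (w - y) (y - z)
            rw [sub_add_sub_cancel] at this
            linarith
      rw [le_div_iff₀ (by positivity)] at hstep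
      rw [pow_succ, mul_comm]
      exact hstep
  have hvz : η ^ J ≤ v z := by
    refine hmain J 0 (by omega) z (fun j hj => ?_) ?_ (by simp)
    · obtain rfl : j = 0 := by omega
      exact ⟨z, by simp, by linarith [hz.1], by linarith [hz.2]⟩
    · have := ha_ge 0
      exact ⟨by linarith [hz.1], by linarith [hz.2]⟩
  refine ⟨fun x => 1 - v x, ⟨fun x => sub_nonneg.2 (hv1 x), fun x hx => ?_, fun x hx hxC => ?_⟩,
    by linarith⟩
  · have hxD : x ∉ D := not_le.2 hx
    rw [hvout x (fun h => hxD h.2) hxD, sub_zero]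
  · rw [nbrAvg_sub, nbrAvg_const hd]
    have := hvD x ⟨hx, fun h => hxC h.1⟩
    linarith

/-! ### Combining the scales -/

/-- The displacement that scale `i` may cause to the virtual positions of larger scales: none while
`i ∈ W` is waiting, once its range while `i ∈ K` is running, twice its range afterwards. -/
noncomputable def driftBudget (ρ : ℕ → ℝ) (W K : Finset ℕ) (i : ℕ) : ℝ :=
  if i ∈ W then 0 else if i ∈ K then ρ i + 1 else 2 * (ρ i + 1)

theorem driftBudget_nonneg {ρ : ℕ → ℝ} (hρ : ∀ i, 0 ≤ ρ i) (W K : Finset ℕ) (i : ℕ) :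
    0 ≤ driftBudget ρ W K i := by
  have := hρ i
  unfold driftBudget
  split_ifs <;> linarith

theorem driftBudget_le {ρ : ℕ → ℝ} (hρ : ∀ i, 0 ≤ ρ i) (W K : Finset ℕ) (i : ℕ) :
    driftBudget ρ W K i ≤ 2 * (ρ i + 1) := by
  have := hρ i
  unfold driftBudget
  split_ifs <;> linarith

/-- The state of a walk at `x` which makes one attempt at each scale in `A`. The scales in `W` are
waiting for their density `s m` to exceed `1 / 2`. A scale `k ∈ K` is running: its attempt was
launched at `z k`, it has taken the walk to the virtual position `p k`, and `g k` bounds the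
probability that it fails. A step of the walk counts for the smallest running scale only, so that
the virtual positions of the larger ones stand still in the meantime. The remaining scales have
failed. The field `drift` says that virtual positions never deviate much from the true one. -/
structure IsAttemptState (A : Finset ℕ) (s : ℕ → (Fin d → ℤ) → ℝ) (ρ : ℕ → ℝ)
    (C : ℕ → Set (Fin d → ℤ)) (W K : Finset ℕ) (x : Fin d → ℤ) (p z : ℕ → Fin d → ℤ)
    (g : ℕ → (Fin d → ℤ) → ℝ) : Prop where
  disjoint : Disjoint W K
  subset_left : W ⊆ A
  subset_right : K ⊆ A
  waiting : ∀ m ∈ W, s m x ≤ 1 / 2 + 1 / 13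
  barrier : ∀ k ∈ K, IsBarrier (C k) (ρ k) (z k) (g k)
  near : ∀ k ∈ K, ‖p k - z k‖ ≤ ρ k + 1
  drift : ∀ k ∈ K, ‖x - p k - ∑ i ∈ K with i < k, (p i - z i)‖
    ≤ ∑ i ∈ A with i < k, driftBudget ρ W K i

namespace IsAttemptState

variable {A : Finset ℕ} {s : ℕ → (Fin d → ℤ) → ℝ} {ρ : ℕ → ℝ} {C : ℕ → Set (Fin d → ℤ)}
  {W K : Finset ℕ} {x : Fin d → ℤ} {p z : ℕ → Fin d → ℤ} {g : ℕ → (Fin d → ℤ) → ℝ}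

/-- A waiting scale starts to run. -/
theorem launch (h : IsAttemptState A s ρ C W K x p z g) (hρ : ∀ i, 0 ≤ ρ i) {j : ℕ} (hj : j ∈ W)
    {g' : (Fin d → ℤ) → ℝ} (hg' : IsBarrier (C j) (ρ j) x g') :
    IsAttemptState A s ρ C (W.erase j) (insert j K) x (Function.update p j x)
      (Function.update z j x) (Function.update g j g') := by
  have hjK : j ∉ K := Finset.disjoint_left.1 h.disjoint hj
  have hne : ∀ k ∈ K, k ≠ j := fun k hk hkj => hjK (hkj ▸ hk)
  have hbud : ∀ i, driftBudget ρ W K i ≤ driftBudget ρ (W.erase j) (insert j K) i := fun i => by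
    have := hρ i
    by_cases hij : i = j
    · subst hij
      simp only [driftBudget, if_pos hj, Finset.notMem_erase, if_false, Finset.mem_insert_self,
        if_true]
      linarith
    · simp [driftBudget, hij]
  have hsum : ∀ k, ∑ i ∈ insert j K with i < k, (Function.update p j x i - Function.update z j x i)
      = ∑ i ∈ K with i < k, (p i - z i) := fun k => by
    rw [Finset.filter_insert]
    have h1 : ∑ i ∈ K with i < k, (Function.update p j x i - Function.update z j x i)
        = ∑ i ∈ K with i < k, (p i - z i) := Finset.sum_congr rfl fun i hi => by
      have := hne i (Finset.mem_filter.1 hi).1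
      rw [Function.update_of_ne this, Function.update_of_ne this]
    split_ifs
    · rw [Finset.sum_insert fun hc => hjK (Finset.mem_filter.1 hc).1, h1]
      simp
    · exact h1
  refine ⟨?_, (Finset.erase_subset _ _).trans h.subset_left,
    Finset.insert_subset (h.subset_left hj) h.subset_right,
    fun m hm => h.waiting m (Finset.mem_of_mem_erase hm), fun k hk => ?_, fun k hk => ?_,
    fun k hk => ?_⟩
  · rw [Finset.disjoint_insert_right]
    exact ⟨Finset.notMem_erase _ _, h.disjoint.mono_left (Finset.erase_subset _ _)⟩
  · rcases Finset.mem_insert.1 hk with rfl | hk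
    · simpa using hg'
    · simpa [hne k hk] using h.barrier k hk
  · rcases Finset.mem_insert.1 hk with rfl | hk
    · have := hρ k
      simp only [Function.update_self, sub_self, norm_zero]
      linarith
    · simpa [hne k hk] using h.near k hk
  · rw [hsum]
    rcases Finset.mem_insert.1 hk with rfl | hk
    · rw [Function.update_self, sub_self, zero_sub, norm_neg]
      refine (norm_sum_le _ _).trans ?_
      calc ∑ i ∈ K with i < k, ‖p i - z i‖
          ≤ ∑ i ∈ K with i < k, driftBudget ρ (W.erase k) (insert k K) i := by
            refine Finset.sum_le_sum fun i hi => ?_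
            have hiK := (Finset.mem_filter.1 hi).1
            have hiW : i ∉ W := Finset.disjoint_right.1 h.disjoint hiK
            simpa [driftBudget, hiW, hiK] using h.near i hiK
        _ ≤ _ := Finset.sum_le_sum_of_subset_of_nonneg
            (Finset.filter_subset_filter _ h.subset_right)
            fun i _ _ => driftBudget_nonneg hρ _ _ i
    · rw [Function.update_of_ne (hne k hk)]
      exact (h.drift k hk).trans (Finset.sum_le_sum fun i _ => hbud i)

/-- The smallest running scale fails. -/
theorem fail (h : IsAttemptState A s ρ C W K x p z g) {k : ℕ} (hk : k ∈ K)
    (hmin : ∀ i ∈ K, k ≤ i) : IsAttemptState A s ρ C W (K.erase k) x p z g := by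
  have hkW : k ∉ W := Finset.disjoint_right.1 h.disjoint hk
  refine ⟨h.disjoint.mono_right (Finset.erase_subset _ _), h.subset_left,
    (Finset.erase_subset _ _).trans h.subset_right, h.waiting,
    fun i hi => h.barrier i (Finset.mem_of_mem_erase hi),
    fun i hi => h.near i (Finset.mem_of_mem_erase hi), fun l hl => ?_⟩
  have hlK := Finset.mem_of_mem_erase hl
  have hkl : k < l := lt_of_le_of_ne (hmin l hlK) (Finset.ne_of_mem_erase hl).symm
  have hmem : k ∈ K.filter (· < l) := Finset.mem_filter.2 ⟨hk, hkl⟩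
  have hmemA : k ∈ A.filter (· < l) := Finset.mem_filter.2 ⟨h.subset_right hk, hkl⟩
  have e1 : x - p l - ∑ i ∈ K.erase k with i < l, (p i - z i)
      = (x - p l - ∑ i ∈ K with i < l, (p i - z i)) + (p k - z k) := by
    rw [Finset.filter_erase, ← Finset.add_sum_erase _ _ hmem]
    abel
  have e2 : ∑ i ∈ A with i < l, driftBudget ρ W (K.erase k) i
      = ∑ i ∈ A with i < l, driftBudget ρ W K i + (ρ k + 1) := by
    rw [← Finset.add_sum_erase _ _ hmemA, ← Finset.add_sum_erase _ (driftBudget ρ W K) hmemA]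
    have h1 : ∑ i ∈ (A.filter (· < l)).erase k, driftBudget ρ W (K.erase k) i
        = ∑ i ∈ (A.filter (· < l)).erase k, driftBudget ρ W K i :=
      Finset.sum_congr rfl fun i hi => by
        simp [driftBudget, Finset.ne_of_mem_erase hi]
    have h2 : driftBudget ρ W (K.erase k) k = 2 * (ρ k + 1) := by simp [driftBudget, hkW]
    have h3 : driftBudget ρ W K k = ρ k + 1 := by simp [driftBudget, hkW, hk]
    rw [h1, h2, h3]
    ring
  rw [e1, e2]
  exact (norm_add_le _ _).trans (add_le_add (h.drift l hlK) (h.near k hk))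

/-- The walk moves, together with the virtual position of the smallest running scale. -/
theorem move (h : IsAttemptState A s ρ C W K x p z g) {k : ℕ} (hk : k ∈ K)
    (hmin : ∀ i ∈ K, k ≤ i) {y : Fin d → ℤ} (hwait : ∀ m ∈ W, s m (x + y) ≤ 1 / 2 + 1 / 13)
    (hnear : ‖p k + y - z k‖ ≤ ρ k + 1) :
    IsAttemptState A s ρ C W K (x + y) (Function.update p k (p k + y)) z g := by
  refine ⟨h.disjoint, h.subset_left, h.subset_right, hwait, h.barrier, fun i hi => ?_,
    fun l hl => ?_⟩
  · by_cases hik : i = k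
    · subst hik; simpa using hnear
    · simpa [hik] using h.near i hi
  · refine le_of_eq_of_le (congrArg _ ?_) (h.drift l hl)
    by_cases hlk : l = k
    · subst hlk
      rw [Function.update_self, Finset.filter_false_of_mem fun i hi => not_lt.2 (hmin i hi)]
      simp
    · have hkl : k < l := lt_of_le_of_ne (hmin l hl) (Ne.symm hlk)
      have hmem : k ∈ K.filter (· < l) := Finset.mem_filter.2 ⟨hk, hkl⟩
      rw [Function.update_of_ne hlk, ← Finset.add_sum_erase _ _ hmem,
        ← Finset.add_sum_erase _ (fun i => p i - z i) hmem, Function.update_self,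
        Finset.sum_congr rfl fun i hi => by
          rw [Function.update_of_ne (Finset.ne_of_mem_erase hi)]]
      abel

end IsAttemptState

/-- The failure probability of a family of attempts at the scales in `A`. The attempts overlap in
time, yet each of them succeeds with probability at least `1 - θ` on its own account, because
success is insensitive to the perturbation by all smaller scales (`hcore`). In analytic terms:
`θ ^ #W * ∏ k ∈ K, g k (p k)` is a supersolution in the state `(W, K, x, p)`. -/
theorem le_pow_card_of_attempts (hd : 0 < d) {A : Finset ℕ} {s : ℕ → (Fin d → ℤ) → ℝ}
    {ρ : ℕ → ℝ} (hρ : ∀ i, 0 ≤ ρ i) {C : ℕ → Set (Fin d → ℤ)} {θ : ℝ} (hθ : 0 ≤ θ)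
    {u : (Fin d → ℤ) → ℝ} (hu1 : ∀ x, u x ≤ 1) (hu : ∀ x, u x = 0 ∨ u x ≤ nbrAvg u x)
    (hstep : ∀ m ∈ A, ∀ x e, IsStep e → s m (x + e) ≤ s m x + 1 / 13)
    (hfin : ∀ m ∈ A, {x | s m x ≤ 1 / 2}.Finite)
    (hbar : ∀ m ∈ A, ∀ z, s m z ∈ Set.Icc (1 / 2 : ℝ) (1 / 2 + 1 / 13) →
      ∃ g, IsBarrier (C m) (ρ m) z g ∧ g z ≤ θ)
    (hcore : ∀ m ∈ A, ∀ y ∈ C m, ∀ x, ‖x - y‖ ≤ ∑ i ∈ A with i < m, 2 * (ρ i + 1) → u x = 0)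
    {x₀ : Fin d → ℤ} (hx₀ : ∀ m ∈ A, s m x₀ ≤ 1 / 2) : u x₀ ≤ θ ^ A.card := by
  have hmain : ∀ N : ℕ, ∀ (W K : Finset ℕ) (x : Fin d → ℤ) (p z : ℕ → Fin d → ℤ)
      (g : ℕ → (Fin d → ℤ) → ℝ), 2 * W.card + K.card = N →
      IsAttemptState A s ρ C W K x p z g → u x ≤ θ ^ W.card * ∏ k ∈ K, g k (p k) := by
    intro N
    induction N using Nat.strong_induction_on with
    | _ N ih =>
    -- the bound holds as soon as some scale is about to start or to fail
    have hlaunch : ∀ (W K : Finset ℕ) (x : Fin d → ℤ) (p z : ℕ → Fin d → ℤ)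
        (g : ℕ → (Fin d → ℤ) → ℝ), 2 * W.card + K.card = N →
        IsAttemptState A s ρ C W K x p z g → (∃ j ∈ W, 1 / 2 < s j x) →
        u x ≤ θ ^ W.card * ∏ k ∈ K, g k (p k) := by
      rintro W K x p z g hN h ⟨j, hj, hjx⟩
      obtain ⟨g', hg', hg'θ⟩ := hbar j (h.subset_left hj) x ⟨hjx.le, h.waiting j hj⟩
      have hjK : j ∉ K := Finset.disjoint_left.1 h.disjoint hj
      have hcard := Finset.card_erase_add_one hj
      have h1 := ih (2 * (W.erase j).card + (insert j K).card)
        (by rw [Finset.card_insert_of_notMem hjK]; omega) _ _ _ _ _ _ rfl (h.launch hρ hj hg')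
      rw [Finset.prod_insert hjK, Function.update_self, Function.update_self,
        Finset.prod_congr rfl fun k hk => by
          have hkj : k ≠ j := fun hkj => hjK (hkj ▸ hk)
          rw [Function.update_of_ne hkj, Function.update_of_ne hkj]] at h1
      refine h1.trans ?_
      rw [← hcard, pow_succ, mul_assoc]
      have hprod : 0 ≤ ∏ k ∈ K, g k (p k) :=
        Finset.prod_nonneg fun k hk => (h.barrier k hk).nonneg _
      gcongr
    have hfail : ∀ (W K : Finset ℕ) (x : Fin d → ℤ) (p z : ℕ → Fin d → ℤ)
        (g : ℕ → (Fin d → ℤ) → ℝ), 2 * W.card + K.card = N →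
        IsAttemptState A s ρ C W K x p z g → ∀ k ∈ K, (∀ i ∈ K, k ≤ i) →
        ρ k < ‖p k - z k‖ → u x ≤ θ ^ W.card * ∏ k ∈ K, g k (p k) := by
      intro W K x p z g hN h k hk hmin hout
      have hcard := Finset.card_erase_add_one hk
      have h1 := ih (2 * W.card + (K.erase k).card) (by omega) _ _ _ _ _ _ rfl (h.fail hk hmin)
      refine h1.trans ?_
      rw [← Finset.mul_prod_erase _ _ hk]
      have hprod : 0 ≤ ∏ i ∈ K.erase k, g i (p i) :=
        Finset.prod_nonneg fun i hi => (h.barrier i (Finset.mem_of_mem_erase hi)).nonneg _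
      have h2 := (h.barrier k hk).one_le _ hout
      exact mul_le_mul_of_nonneg_left (le_mul_of_one_le_left hprod h2) (by positivity)
    intro W K x p z g hN h
    by_cases hW : ∃ j ∈ W, 1 / 2 < s j x
    · exact hlaunch W K x p z g hN h hW
    push Not at hW
    rcases K.eq_empty_or_nonempty with rfl | hK
    · rcases W.eq_empty_or_nonempty with rfl | ⟨j, hj⟩
      · simpa using hu1 x
      · have hF := nonpos_of_le_nbrAvg hd (S := {y | ∀ j ∈ W, s j (x + y) ≤ 1 / 2})
          (F := fun y => u (x + y) - θ ^ W.card)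
          (((hfin j (h.subset_left hj)).preimage (add_right_injective x).injOn).subset
            fun y hy => hy j hj)
          (fun y _ => by
            rcases hu (x + y) with h0 | h0
            · left
              rw [h0, zero_sub, neg_nonpos]
              positivity
            · right
              rw [nbrAvg_sub, nbrAvg_const hd, nbrAvg_comp_add]
              linarith)
          (fun y hy e he hye => by
            simp only [Set.mem_ofPred_eq, not_forall, not_le, exists_prop] at hye
            rw [sub_nonpos]
            have h1 : IsAttemptState A s ρ C W ∅ (x + (y + e)) p z g :=
              ⟨h.disjoint, h.subset_left, h.subset_right, fun m hm => by
                have h2 := hy m hm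
                have h3 := hstep m (h.subset_left hm) (x + y) e he
                rw [add_assoc] at h3
                linarith, h.barrier, h.near, by simp⟩
            simpa using hlaunch W ∅ _ p z g hN h1 hye) 0 (by simpa using hW)
        simpa using hF
    · -- the smallest running scale moves along with the walk
      set k := K.min' hK
      have hk : k ∈ K := K.min'_mem hK
      have hmin : ∀ i ∈ K, k ≤ i := fun i hi => K.min'_le i hi
      by_cases hout : ρ k < ‖p k - z k‖
      · exact hfail W K x p z g hN h k hk hmin hout
      rw [not_lt] at hout
      set c := θ ^ W.card * ∏ i ∈ K.erase k, g i (p i) with hc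
      have hc0 : 0 ≤ c := mul_nonneg (by positivity)
        (Finset.prod_nonneg fun i hi => (h.barrier i (Finset.mem_of_mem_erase hi)).nonneg _)
      have hbarrier := h.barrier k hk
      have hprod : ∀ y, θ ^ W.card * ∏ i ∈ K, g i (Function.update p k (p k + y) i)
          = c * g k (p k + y) := fun y => by
        rw [← Finset.mul_prod_erase _ _ hk, Function.update_self,
          Finset.prod_congr rfl fun i hi => by
            rw [Function.update_of_ne (Finset.ne_of_mem_erase hi)], hc]
        ring
      have hF := nonpos_of_le_nbrAvg hd
        (S := {y | ‖p k + y - z k‖ ≤ ρ k ∧ ∀ j ∈ W, s j (x + y) ≤ 1 / 2})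
        (F := fun y => u (x + y) - c * g k (p k + y)) ?_ (fun y hy => ?_)
        (fun y hy e he hye => ?_) 0 ⟨by simpa using hout, by simpa using hW⟩
      · rw [add_zero, add_zero, sub_nonpos] at hF
        rw [← Finset.mul_prod_erase _ _ hk]
        linarith
      · refine (box (z k - p k) ⌈ρ k⌉₊).finite_toSet.subset fun y hy => ?_
        rw [Finset.mem_coe, mem_box_iff_norm, show y - (z k - p k) = p k + y - z k by abel]
        exact hy.1.trans (Nat.le_ceil _)
      · have hst := h.move hk hmin (y := y) (fun m hm => by linarith [hy.2 m hm])
          (by linarith [hy.1])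
        have hg0 := mul_nonneg hc0 (hbarrier.nonneg (p k + y))
        rcases hu (x + y) with h0 | h0
        · left; rw [h0]; linarith
        · by_cases hcr : p k + y ∈ C k
          · left
            have h1 := hst.drift k hk
            rw [Function.update_self, Finset.filter_false_of_mem fun i hi => not_lt.2 (hmin i hi),
              Finset.sum_empty, sub_zero] at h1
            rw [hcore k (h.subset_right hk) _ hcr (x + y)
              (h1.trans (Finset.sum_le_sum fun i _ => driftBudget_le hρ _ _ i))]
            linarith
          · right
            have h1 := mul_le_mul_of_nonneg_left (hbarrier.nbrAvg_le _ hy.1 hcr) hc0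
            rw [nbrAvg_sub, nbrAvg_comp_add, nbrAvg_const_mul, nbrAvg_comp_add (g k)]
            linarith
      · have hnear : ‖p k + (y + e) - z k‖ ≤ ρ k + 1 := by
          have h1 := norm_add_le (p k + y - z k) e
          have h2 : p k + (y + e) - z k = p k + y - z k + e := by abel
          rw [h2]
          linarith [he.norm_le, hy.1]
        have hst := h.move hk hmin (y := y + e) (fun m hm => by
          have h2 := hy.2 m hm
          have h3 := hstep m (h.subset_left hm) (x + y) e he
          rw [add_assoc] at h3
          linarith) hnear
        rw [sub_nonpos, ← hprod]
        by_cases hl : ∃ j ∈ W, 1 / 2 < s j (x + (y + e))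
        · exact hlaunch _ _ _ _ _ _ hN hst hl
        · push Not at hl
          refine hfail _ _ _ _ _ _ hN hst k hk hmin ?_
          rw [Function.update_self]
          by_contra hcon
          exact hye ⟨not_lt.1 hcon, hl⟩
  have h := hmain (2 * A.card + (∅ : Finset ℕ).card) A ∅ x₀ (fun _ => 0) (fun _ => 0)
    (fun _ _ => 0) rfl
    ⟨Finset.disjoint_empty_right _, subset_rfl, Finset.empty_subset _,
      fun m hm => by linarith [hx₀ m hm], by simp, by simp, by simp⟩
  simpa using h

/-! ### The jump chain and its avoidance probabilities -/

/-- The sequences of steps along which the jump chain started at `x` never visits `D`. -/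
def avoidSet (D : Set (Fin d → ℤ)) (x : Fin d → ℤ) : Set (ℕ → Fin d → ℤ) :=
  {ω | ∀ n, x + ∑ k ∈ Finset.range n, ω k ∉ D}

theorem measurableSet_avoidSet (D : Set (Fin d → ℤ)) (x : Fin d → ℤ) :
    MeasurableSet (avoidSet D x) := by
  have : avoidSet D x
      = ⋂ n, (fun ω : ℕ → Fin d → ℤ => x + ∑ k ∈ Finset.range n, ω k) ⁻¹' Dᶜ := by
    ext ω; simp [avoidSet]
  rw [this]
  refine MeasurableSet.iInter fun n => ?_
  exact (Measurable.const_add (by fun_prop) x) (Set.to_countable Dᶜ).measurableSet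

/-- Prepending a first term to a sequence. -/
def consSeq {E : Type*} (p : E × (ℕ → E)) : ℕ → E := fun n => Nat.casesOn n p.1 p.2

theorem measurable_consSeq {E : Type*} [MeasurableSpace E] :
    Measurable (consSeq : E × (ℕ → E) → ℕ → E) := by
  refine measurable_pi_lambda _ fun n => ?_
  cases n with
  | zero => exact measurable_fst
  | succ n => exact (measurable_pi_apply n).comp measurable_snd

/-- An i.i.d. sequence consists of its first term and an independent copy of itself. -/
theorem map_consSeq_infinitePi {E : Type*} [MeasurableSpace E] (μ : Measure E)
    [IsProbabilityMeasure μ] :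
    (μ.prod (Measure.infinitePi fun _ : ℕ => μ)).map consSeq
      = Measure.infinitePi fun _ : ℕ => μ := by
  classical
  refine Measure.eq_infinitePi _ fun s t ht => ?_
  obtain ⟨N, hN⟩ : ∃ N, s ⊆ Finset.range (N + 1) :=
    s.exists_nat_subset_range.imp fun N hN => hN.trans (Finset.range_mono N.le_succ)
  let t' : ℕ → Set E := fun i => if i ∈ s then t i else Set.univ
  have ht' : ∀ i, MeasurableSet (t' i) := fun i => by
    simp only [t']
    split_ifs
    exacts [ht i, .univ]
  have h1 : Set.pi (s : Set ℕ) t = Set.pi (Finset.range (N + 1) : Set ℕ) t' := by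
    ext ω
    simp only [Set.mem_pi, Finset.mem_coe, t']
    refine ⟨fun h i _ => ?_, fun h i hi => ?_⟩
    · split_ifs with hi
      exacts [h i hi, trivial]
    · simpa [hi] using h i (hN hi)
  have h2 : ∏ i ∈ s, μ (t i) = ∏ i ∈ Finset.range (N + 1), μ (t' i) := by
    rw [← Finset.prod_subset hN fun i _ hi => by simp [t', hi]]
    exact Finset.prod_congr rfl fun i hi => by simp [t', hi]
  have h3 : consSeq ⁻¹' Set.pi (Finset.range (N + 1) : Set ℕ) t'
      = t' 0 ×ˢ Set.pi (Finset.range N : Set ℕ) fun i => t' (i + 1) := by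
    ext ⟨e, ω⟩
    simp only [Set.mem_preimage, Set.mem_pi, Finset.mem_coe, Finset.mem_range, Set.mem_prod]
    refine ⟨fun h => ⟨h 0 (by omega), fun i hi => h (i + 1) (by omega)⟩, fun h i hi => ?_⟩
    cases i with
    | zero => exact h.1
    | succ i => exact h.2 i (by omega)
  have hmeas : MeasurableSet (Set.pi (Finset.range (N + 1) : Set ℕ) t') :=
    MeasurableSet.pi (Finset.countable_toSet _) fun i _ => ht' i
  rw [h1, h2, Measure.map_apply measurable_consSeq hmeas, h3, Measure.prod_prod,
    Measure.infinitePi_pi _ fun i _ => ht' (i + 1), Finset.prod_range_succ', mul_comm]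

/-- The probability that the jump chain started at `x` never visits `D`. -/
noncomputable def avoidProb (D : Set (Fin d → ℤ)) (x : Fin d → ℤ) : ℝ :=
  (Measure.infinitePi fun _ : ℕ => stepLaw d).real (avoidSet D x)

theorem avoidProb_eq_zero {D : Set (Fin d → ℤ)} {x : Fin d → ℤ} (hx : x ∈ D) :
    avoidProb D x = 0 := by
  have : avoidSet D x = ∅ :=
    Set.eq_empty_of_forall_notMem fun ω hω => hω 0 (by simpa using hx)
  rw [avoidProb, this, measureReal_empty]

theorem lintegral_stepLaw (f : (Fin d → ℤ) → ℝ≥0∞) :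
    ∫⁻ e, f e ∂(stepLaw d)
      = (2 * d : ℝ≥0∞)⁻¹ * ∑ i : Fin d, (f (Pi.single i 1) + f (Pi.single i (-1))) := by
  rw [stepLaw, lintegral_smul_measure, lintegral_finsetSum_measure, smul_eq_mul]
  congr 1
  refine Finset.sum_congr rfl fun i _ => ?_
  rw [lintegral_add_measure, lintegral_dirac, lintegral_dirac]

theorem avoidProb_eq_nbrAvg (hd : 1 ≤ d) {D : Set (Fin d → ℤ)} {x : Fin d → ℤ} (hx : x ∉ D) :
    avoidProb D x = nbrAvg (avoidProb D) x := by
  have := isProbabilityMeasure_stepLaw hd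
  set μ := Measure.infinitePi fun _ : ℕ => stepLaw d with hμ
  have hpre : ∀ e, Prod.mk e ⁻¹' (consSeq ⁻¹' avoidSet D x) = avoidSet D (x + e) := fun e => by
    ext ω
    simp only [Set.mem_preimage, avoidSet, Set.mem_ofPred_eq]
    refine ⟨fun h n => ?_, fun h n => ?_⟩
    · have h1 := h (n + 1)
      rw [Finset.sum_range_succ', add_comm (∑ k ∈ Finset.range n, _), ← add_assoc] at h1
      exact h1
    · cases n with
      | zero => simpa using hx
      | succ n =>
        rw [Finset.sum_range_succ', add_comm (∑ k ∈ Finset.range n, _), ← add_assoc]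
        exact h n
  have h1 : μ (avoidSet D x) = (2 * d : ℝ≥0∞)⁻¹ * ∑ i : Fin d,
      (μ (avoidSet D (x + Pi.single i 1)) + μ (avoidSet D (x + Pi.single i (-1)))) := by
    have hms := measurableSet_avoidSet D x
    conv_lhs => rw [hμ, ← map_consSeq_infinitePi (stepLaw d)]
    rw [Measure.map_apply measurable_consSeq hms,
      Measure.prod_apply (measurable_consSeq hms), lintegral_stepLaw]
    simp only [hpre, hμ]
  have hfin : ∀ y, μ (avoidSet D y) ≠ ⊤ := fun y => measure_ne_top _ _
  simp only [avoidProb, nbrAvg, Measure.real]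
  rw [← hμ, h1, ENNReal.toReal_mul, ENNReal.toReal_inv,
    ENNReal.toReal_sum fun i _ => ENNReal.add_ne_top.2 ⟨hfin _, hfin _⟩]
  have h2 : (2 * d : ℝ≥0∞).toReal = 2 * d := by simp
  rw [h2]
  congr 1
  exact Finset.sum_congr rfl fun i _ => ENNReal.toReal_add (hfin _) (hfin _)

theorem avoidProb_le_one (hd : 1 ≤ d) (D : Set (Fin d → ℤ)) (x : Fin d → ℤ) :
    avoidProb D x ≤ 1 := by
  have := isProbabilityMeasure_stepLaw hd
  exact measureReal_le_one

theorem ae_pos_expMeasure : ∀ᵐ t ∂(expMeasure 1), 0 < t := by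
  have := isProbabilityMeasure_expMeasure (r := 1) one_pos
  rw [ae_iff]
  have h1 : {t : ℝ | ¬ 0 < t} = Set.Iic 0 := by ext; simp
  have h2 := cdf_expMeasure_eq (r := 1) one_pos 0
  rw [cdf_eq_real] at h2
  rw [h1, ← measureReal_eq_zero_iff, h2]
  simp

/-- When all holding times are positive, the walk visits all points of its jump chain: the `n`-th
one at the time of the `n`-th jump. -/
theorem walk_jumpTime {x : Fin d → ℤ} {ω : Sample d} (hω : ∀ k, 0 < ω.2 k) (n : ℕ) :
    ∃ t : ℝ≥0, walk x t ω = x + ∑ k ∈ Finset.range n, ω.1 k := by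
  have hmono : StrictMono fun n => jumpTime n ω := strictMono_nat_of_lt_succ fun n => by
    simp only [jumpTime, Finset.sum_range_succ]
    linarith [hω n]
  refine ⟨⟨jumpTime n ω, Finset.sum_nonneg fun k _ => (hω k).le⟩, ?_⟩
  have h1 : jumpCount ⟨jumpTime n ω, Finset.sum_nonneg fun k _ => (hω k).le⟩ ω = n := by
    have : {k : ℕ | jumpTime (k + 1) ω ≤ jumpTime n ω} = (Finset.range n : Set ℕ) := by
      ext k
      simp only [Set.mem_ofPred_eq, Finset.coe_range, Set.mem_Iio]
      exact hmono.le_iff_le.trans Nat.succ_le_iff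
    change Set.ncard {k : ℕ | jumpTime (k + 1) ω ≤ jumpTime n ω} = n
    rw [this, Set.ncard_coe_finset, Finset.card_range]
  change x + ∑ k ∈ Finset.range (jumpCount _ ω), ω.1 k = _
  rw [h1]

theorem real_entranceTime_eq_top_le (hd : 1 ≤ d) (D : Set (Fin d → ℤ)) (x : Fin d → ℤ) :
    (walkMeasure d).real {ω | entranceTime x D ω = ⊤} ≤ avoidProb D x := by
  have := isProbabilityMeasure_stepLaw hd
  have := isProbabilityMeasure_expMeasure (r := 1) one_pos
  have hpos : ∀ᵐ ω ∂(walkMeasure d), ∀ k, 0 < ω.2 k := by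
    refine Measure.quasiMeasurePreserving_snd.ae
      (p := fun τ : ℕ → ℝ => ∀ k, 0 < τ k) (ae_all_iff.2 fun k => ?_)
    exact (measurePreserving_eval_infinitePi (fun _ : ℕ => expMeasure 1)
      k).quasiMeasurePreserving.ae ae_pos_expMeasure
  have hle : walkMeasure d {ω | entranceTime x D ω = ⊤}
      ≤ walkMeasure d (avoidSet D x ×ˢ Set.univ) := by
    refine measure_mono_ae ?_
    filter_upwards [hpos] with ω hω htop
    refine ⟨fun n => ?_, trivial⟩
    obtain ⟨t, ht⟩ := walk_jumpTime (x := x) hω n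
    rw [← ht]
    exact hittingAfter_eq_top_iff.1 htop t zero_le
  rw [walkMeasure, Measure.prod_prod, measure_univ, mul_one] at hle
  exact ENNReal.toReal_mono (measure_ne_top _ _) hle

/-! ### Resonance sets -/

theorem le_of_minSeparation_le {d J L : ℕ} (hd : 1 ≤ d) (hJ : 1 ≤ J)
    (hL : minSeparation d J ≤ L) : 5 ≤ L ∧ d * ((2 : ℝ) ^ L)⁻¹ ≤ 1 / (200 * J) := by
  have hJ0 : (0 : ℝ) < J := by exact_mod_cast hJ
  have hd0 : (0 : ℝ) < d := by exact_mod_cast hd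
  have hne : {L : ℕ | 5 ≤ L ∧
      (d : ℝ) * 2 ^ (d - 1) * ((2 : ℝ) ^ L)⁻¹ ≤ (200 * (J : ℝ))⁻¹}.Nonempty := by
    have h1 : Tendsto (fun n : ℕ => (d : ℝ) * 2 ^ (d - 1) * ((2 : ℝ) ^ n)⁻¹) atTop
        (𝓝 (d * 2 ^ (d - 1) * 0)) := by
      simp only [← inv_pow]
      exact (tendsto_pow_atTop_nhds_zero_of_lt_one (by norm_num) (by norm_num)).const_mul _
    rw [mul_zero] at h1
    obtain ⟨n, hn1, hn2⟩ := ((eventually_ge_atTop 5).and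
      (h1.eventually_le_const (show (0 : ℝ) < (200 * (J : ℝ))⁻¹ by positivity))).exists
    exact ⟨n, hn1, hn2⟩
  obtain ⟨h5, h6⟩ := Nat.sInf_mem hne
  change 5 ≤ minSeparation d J at h5
  change (d : ℝ) * 2 ^ (d - 1) * ((2 : ℝ) ^ minSeparation d J)⁻¹ ≤ _ at h6
  refine ⟨h5.trans hL, ?_⟩
  rw [one_div]
  refine le_trans ?_ h6
  rw [mul_assoc]
  refine mul_le_mul_of_nonneg_left ?_ hd0.le
  calc ((2 : ℝ) ^ L)⁻¹ ≤ ((2 : ℝ) ^ minSeparation d J)⁻¹ := by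
        gcongr; norm_num
    _ ≤ 2 ^ (d - 1) * ((2 : ℝ) ^ minSeparation d J)⁻¹ :=
        le_mul_of_one_le_left (by positivity) (one_le_pow₀ (by norm_num))

/-- Points that are close to the balanced core of the scale `m`, within half of its smallest
radius, belong to the resonance set. -/
theorem mem_resonanceSet {U : Set (Fin d → ℤ)} {L₁ J L m : ℕ} {A : Finset ℕ} (hL : 1 ≤ L)
    (hm : m ∈ A) (hmL : J * L ≤ m) {x y : Fin d → ℤ}
    (hy : y ∈ balancedCore U (fun j => 2 ^ (m - j * L) * L₁) J)
    (hxy : ‖x - y‖ ≤ ((2 ^ (m - J * L) * L₁ : ℕ) : ℝ) / 2) :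
    x ∈ resonanceSet U L₁ (enlargedScales J L A) J := by
  classical
  have hsub : ∀ j ∈ Finset.range J, j * L ≤ J * L := fun j hj =>
    Nat.mul_le_mul_right L (Finset.mem_range.1 hj).le
  set T : Finset ℕ := (Finset.range J).image fun j => m - j * L with hT
  have hTcard : T.card = J := by
    rw [hT, Finset.card_image_of_injOn, Finset.card_range]
    intro i hi j hj hij
    have h1 := hsub i hi
    have h2 := hsub j hj
    simp only at hij
    exact Nat.eq_of_mul_eq_mul_right hL (by omega : i * L = j * L)
  have hfin : (enlargedScales J L A).Finite := by
    refine (Finset.range (A.sup id + 1)).finite_toSet.subset ?_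
    rintro n ⟨j, _, hj⟩
    have := Finset.le_sup (f := id) hj
    simp only [id] at this
    simp only [Finset.coe_range, Set.mem_Iio]
    omega
  change J ≤ Set.ncard _
  refine (hTcard.symm.trans (Set.ncard_coe_finset T).symm).trans_le ?_
  refine Set.ncard_le_ncard (fun n hn => ?_) (hfin.subset (Set.sep_subset _ _))
  obtain ⟨j, hj, rfl⟩ := Finset.mem_image.1 (Finset.mem_coe.1 hn)
  have hjJ := (Finset.mem_range.1 hj).le
  have hjL := hsub j hj
  obtain ⟨w, hw, hdens⟩ := hy j hjJ
  refine ⟨⟨j, hjJ, by rwa [Nat.sub_add_cancel (hjL.trans hmL)]⟩, ?_⟩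
  have hRle : ((2 ^ (m - J * L) * L₁ : ℕ) : ℝ) ≤ (2 ^ (m - j * L) * L₁ : ℕ) :=
    Nat.cast_le.2 (Nat.mul_le_mul_right _ (Nat.pow_le_pow_right two_pos (by omega)))
  have hfinal := density_mem_Icc_alphaTilde U (y := x) hdens (by
    have := norm_add_le (x - y) (y - w)
    rw [sub_add_sub_cancel] at this
    linarith)
  have e1 : ((2 : ℝ) ^ (m - j * L + 2) * L₁) = ((4 * (2 ^ (m - j * L) * L₁) : ℕ) : ℝ) := by
    push_cast; ring
  rw [e1]
  exact hfinal

/-- Scales in `A` are so sparse that all attempts at the scales below `m` together move the walk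
by less than half of the smallest radius involved in the attempt at `m`. -/
theorem sum_range_le {L₁ J L h m : ℕ} (hL₁ : 2 ≤ L₁) (hL : 5 ≤ L) {A : Finset ℕ}
    (hA : ∀ i ∈ A, ∃ k : ℕ, 1 ≤ k ∧ i = (J + 1) * L * k + h) (hm : m ∈ A) :
    ∑ i ∈ A with i < m, 2 * (3 * ((2 ^ i * L₁ : ℕ) : ℝ) + 1)
      ≤ ((2 ^ (m - J * L) * L₁ : ℕ) : ℝ) / 2 := by
  obtain ⟨k, hk1, hk⟩ := hA m hm
  have hmul : (J + 1) * L * k = (J + 1) * L * (k - 1) + J * L + L := by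
    obtain ⟨k', rfl⟩ : ∃ k', k = k' + 1 := ⟨k - 1, by omega⟩
    rw [Nat.add_sub_cancel]; ring
  set q := (J + 1) * L * (k - 1) + h with hq
  have hle : ∀ i ∈ A.filter (· < m), i ≤ q := fun i hi => by
    rw [Finset.mem_filter] at hi
    obtain ⟨k', _, hk'⟩ := hA i hi.1
    have h1 : k' < k := by
      have h2 := hi.2
      rw [hk', hk] at h2
      exact lt_of_mul_lt_mul_left (Nat.lt_of_add_lt_add_right h2) (Nat.zero_le _)
    rw [hk', hq]
    exact Nat.add_le_add_right (Nat.mul_le_mul_left _ (by omega)) h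
  have hsum : ∑ i ∈ A with i < m, 2 ^ i ≤ 2 * 2 ^ q := by
    refine (Finset.sum_le_sum_of_subset (t := Finset.range (q + 1)) fun i hi => ?_).trans ?_
    · exact Finset.mem_range.2 (Nat.lt_succ_of_le (hle i hi))
    · rw [Nat.geomSum_eq le_rfl, pow_succ]; simp only [Nat.reduceSub, Nat.div_one]; omega
  have hterm : ∀ i ∈ A.filter (· < m), 2 * (3 * ((2 ^ i * L₁ : ℕ) : ℝ) + 1)
      ≤ 7 * L₁ * ((2 ^ i : ℕ) : ℝ) := fun i _ => by
    have h1 : (2 : ℝ) ≤ L₁ := by exact_mod_cast hL₁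
    have h2 : (1 : ℝ) ≤ 2 ^ i := one_le_pow₀ (by norm_num)
    push_cast
    nlinarith
  refine (Finset.sum_le_sum hterm).trans ?_
  rw [← Finset.mul_sum, ← Nat.cast_sum]
  have h3 : ((∑ i ∈ A with i < m, 2 ^ i : ℕ) : ℝ) ≤ 2 * 2 ^ q := by exact_mod_cast hsum
  have h4 : m - J * L = q + L := by omega
  have h5 : (32 : ℝ) ≤ 2 ^ L := by
    calc (32 : ℝ) = 2 ^ 5 := by norm_num
      _ ≤ 2 ^ L := pow_le_pow_right₀ (by norm_num) hL
  have h6 : (0 : ℝ) ≤ L₁ * 2 ^ q := by positivity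
  have h7 : ((2 ^ (q + L) * L₁ : ℕ) : ℝ) = 2 ^ L * (L₁ * 2 ^ q) := by push_cast; ring
  rw [h4, h7]
  calc (7 : ℝ) * L₁ * ((∑ i ∈ A with i < m, 2 ^ i : ℕ) : ℝ) ≤ 7 * L₁ * (2 * 2 ^ q) := by gcongr
    _ ≤ 32 * (L₁ * 2 ^ q) / 2 := by linarith
    _ ≤ 2 ^ L * (L₁ * 2 ^ q) / 2 := by gcongr

theorem avoidProb_resonanceSet_le (hd : 1 ≤ d) {J L₁ L h : ℕ} (hJ : 1 ≤ J) (hL₁ : 13 * d ≤ L₁)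
    (hL : minSeparation d J ≤ L) (U₀ : Finset (Fin d → ℤ)) {A : Finset ℕ}
    (hA : ∀ i ∈ A, ∃ k : ℕ, 1 ≤ k ∧ i = (J + 1) * L * k + h) {x : Fin d → ℤ}
    (hx : ∀ m ∈ A, density (U₀ : Set (Fin d → ℤ))ᶜ x (2 ^ m * L₁ : ℕ) ≤ 1 / 2) :
    avoidProb (resonanceSet (U₀ : Set (Fin d → ℤ))ᶜ L₁ (enlargedScales J L A) J) x
      ≤ (1 - descentProb d J ^ J) ^ A.card := by
  obtain ⟨hL5, hLd⟩ := le_of_minSeparation_le hd hJ hL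
  set U : Set (Fin d → ℤ) := (U₀ : Set (Fin d → ℤ))ᶜ
  have hrad : ∀ m, L₁ ≤ 2 ^ m * L₁ := fun m => Nat.le_mul_of_pos_left _ (by positivity)
  have hJL : ∀ m ∈ A, J * L + L ≤ m := fun m hm => by
    obtain ⟨k, hk1, hk⟩ := hA m hm
    have : (J + 1) * L * 1 ≤ (J + 1) * L * k := Nat.mul_le_mul_left _ hk1
    have h2 : (J + 1) * L * 1 = J * L + L := by ring
    omega
  refine le_pow_card_of_attempts hd (s := fun m x => density U x (2 ^ m * L₁ : ℕ))
    (ρ := fun m => 3 * ((2 ^ m * L₁ : ℕ) : ℝ)) (fun m => by positivity)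
    (C := fun m => balancedCore U (fun j => 2 ^ (m - j * L) * L₁) J)
    (sub_nonneg.2 (pow_le_one₀ (descentProb_pos d hJ).le (descentProb_le_one d hJ)))
    (avoidProb_le_one hd _) (fun x => ?_) (fun m hm x e he => ?_)
    (fun m hm => finite_density_compl_le_half U₀ _) (fun m hm z hz => ?_)
    (fun m hm y hy x hxy => ?_) hx
  · by_cases h : x ∈ resonanceSet U L₁ (enlargedScales J L A) J
    · exact Or.inl (avoidProb_eq_zero h)
    · exact Or.inr (avoidProb_eq_nbrAvg hd h).le
  · have := (abs_le.1 (density_step U (x := x) he (hL₁.trans (hrad m))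
      (by have := hrad m; omega))).2
    linarith
  · have hsplit : ∀ j < J, m - j * L = m - (j + 1) * L + L := fun j hj => by
      have h1 : (j + 1) * L ≤ J * L := Nat.mul_le_mul_right L hj
      have h2 := hJL m hm
      have h3 : (j + 1) * L = j * L + L := by ring
      omega
    have hb := exists_isBarrier_balancedCore hd U hJ (R := fun j => 2 ^ (m - j * L) * L₁)
      (fun j _ => hL₁.trans (hrad _)) (fun j _ => by have := hrad (m - j * L); omega)
      (fun j hj => ?_) (fun j hj => ?_) (z := z) (by simpa using hz)
    · simpa using hb
    · have h4 : 2 ^ 5 ≤ 2 ^ L := Nat.pow_le_pow_right two_pos hL5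
      rw [hsplit j hj, pow_add]
      calc 32 * (2 ^ (m - (j + 1) * L) * L₁)
          = 2 ^ (m - (j + 1) * L) * 2 ^ 5 * L₁ := by ring
        _ ≤ _ := by gcongr
    · have h5 : (0 : ℝ) < L₁ := by
        have : 0 < L₁ := by omega
        positivity
      have h6 : ((2 ^ (m - (j + 1) * L) * L₁ : ℕ) : ℝ) / ((2 ^ (m - j * L) * L₁ : ℕ) : ℝ)
          = ((2 : ℝ) ^ L)⁻¹ := by
        rw [hsplit j hj, pow_add]
        push_cast
        field_simp
      rw [h6]
      exact hLd
  · exact avoidProb_eq_zero (mem_resonanceSet (by omega) hm (by have := hJL m hm; omega) hy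
      (hxy.trans (sum_range_le (by omega) hL5 hA hm)))

end ResonanceSets


open ResonanceSets in
theorem proposition3p1 (d : ℕ) (hd : 3 ≤ d) :
    ∃ (γ : ℕ → ℕ → ℝ) (rmin : ℕ → ℕ),
      (∀ I J : ℕ, 1 ≤ I → 1 ≤ J → 0 ≤ γ I J) ∧
      (∀ J : ℕ, 1 ≤ J → Tendsto (fun I : ℕ => γ I J) atTop (𝓝 0)) ∧
      (∀ J : ℕ, 1 ≤ J → 6 ≤ rmin J) ∧
      ∀ I J : ℕ, 1 ≤ I → 1 ≤ J → ∀ L₁ : ℕ, rmin J ≤ L₁ →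
        ∀ U₀ : Finset (Fin d → ℤ), U₀.Nonempty →
        ∀ L : ℕ, minSeparation d J ≤ L →
        ∀ (h : ℕ) (A : Finset ℕ), (∀ m ∈ A, ∃ k : ℕ, 1 ≤ k ∧ m = (J + 1) * L * k + h) →
        (∀ m ∈ A, ((ball 0 (2 ^ m * L₁) ∩ (U₀ : Set (Fin d → ℤ))ᶜ).ncard : ℝ)
          ≤ 1 / 2 * ((ball (0 : Fin d → ℤ) (2 ^ m * L₁)).ncard : ℝ)) →
        A.card = I →
        (walkMeasure d).real
          {ω | entranceTime 0
            (resonanceSet (U₀ : Set (Fin d → ℤ))ᶜ L₁ (enlargedScales J L A) J) ω = ⊤}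
          ≤ γ I J := by
  have hd1 : 1 ≤ d := by omega
  refine ⟨fun I J => (1 - descentProb d J ^ J) ^ I, fun _ => 13 * d, fun I J _ hJ => ?_,
    fun J hJ => ?_, fun J _ => show 6 ≤ 13 * d by omega, ?_⟩
  · exact pow_nonneg (sub_nonneg.2
      (pow_le_one₀ (descentProb_pos d hJ).le (descentProb_le_one d hJ))) _
  · refine tendsto_pow_atTop_nhds_zero_of_lt_one (sub_nonneg.2
      (pow_le_one₀ (descentProb_pos d hJ).le (descentProb_le_one d hJ))) ?_
    have := pow_pos (descentProb_pos d hJ) J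
    linarith
  · intro I J _ hJ L₁ hL₁ U₀ _ L hL h A hA hhalf hcard
    subst hcard
    refine (real_entranceTime_eq_top_le hd1 _ 0).trans
      (avoidProb_resonanceSet_le hd1 hJ hL₁ hL U₀ hA fun m hm => ?_)
    have h1 := hhalf m hm
    have h2 : (0 : ℝ) < (ball (0 : Fin d → ℤ) ((2 ^ m * L₁ : ℕ) : ℝ)).ncard := by
      rw [← coe_box, Set.ncard_coe_finset, card_box]
      positivity
    rw [density, div_le_iff₀ h2]
    push_cast at h2 ⊢
    exact h1
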